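/- Let $R=\bigoplus_{n\ge 0}R_n$ be a standard graded Noetherian commutative ring (that is, $R$ is generated as an $R_0$-algebra by $R_1$), let $R_+=\bigoplus_{n>0}R_n$ be its irrelevant ideal, let $\mathfrak a_0$ be an ideal of $R_0$ and put $\mathfrak a=\mathfrak a_0R+R_+$. Let $M$ and $N$ be finitely generated $\mathbb Z$-graded $R$-modules. For $i\ge 0$ let $$H^i_{\mathfrak a}(M,N)=\varinjlim_{k}\operatorname{Ext}^i_R(M/\mathfrak a^kM,N)$$ be the $i$-th generalized local cohomology module with its natural $\mathbb Z$-grading, induced by the gradings of the modules $\operatorname{Ext}^i_R(M/\mathfrak a^kM,N)$. A graded module $X=\bigoplus_{n\in\mathbb Z}X_n$ is called finitely graded if $X_n=0$ for all but finitely many $n\in\mathbb Z$. Define, as elements of $\mathbb N_0\cup\{\infty\}$, $$\upsilon_{\mathfrak a}(M,N)=\sup\{k\in\mathbb N_0 : H^i_{\mathfrak a}(M,N)\text{ is finitely graded for all } i<k\},$$ $$f_{\mathfrak a}^{R_+}(M,N)=\sup\{k\in\mathbb N_0 : R_+\subseteq\sqrt{0:_R H^i_{\mathfrak a}(M,N)}\text{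 for all } i<k\}.$$ If $M$ has finite projective dimension over $R$, then $$\upsilon_{\mathfrak a}(M,N)=f_{\mathfrak a}^{R_+}(M,N).$$ -/

import Mathlib

open CategoryTheory

universe u

namespace GradedGLC

noncomputable section

variable {R : Type u} [CommRing R]

/-- The family `ℳ` of additive subgroups makes `M` a `ℤ`-graded module over `R`, which is graded
by `𝒜`: `M = ⨁ₙ ℳ n` and `𝒜 m • ℳ n ⊆ ℳ (m + n)`. -/
structure IsGradedModule (𝒜 : ℕ → AddSubgroup R) {M : Type u} [AddCommGroup M] [Module R M]
    (ℳ : ℤ → AddSubgroup M) : Prop where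
  isInternal : DirectSum.IsInternal ℳ
  smul_mem : ∀ (m : ℕ) (n : ℤ) (a : R) (x : M), a ∈ 𝒜 m → x ∈ ℳ n → a • x ∈ ℳ ((m : ℤ) + n)

/-- An additive map `f` is homogeneous of degree `d`: it maps the `n`-th piece into the
`(n + d)`-th piece. -/
def IsHomogeneousOfDegree {M N : Type u} [AddCommGroup M] [AddCommGroup N]
    (ℳ : ℤ → AddSubgroup M) (𝒩 : ℤ → AddSubgroup N) (d : ℤ) (f : M →+ N) : Prop :=
  ∀ (n : ℤ) (x : M), x ∈ ℳ n → f x ∈ 𝒩 (n + d)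

/-- The pieces of the grading induced on the quotient `M ⧸ L`: the images of the pieces of `M`. -/
def quotientGrading {M : Type u} [AddCommGroup M] [Module R M] (ℳ : ℤ → AddSubgroup M)
    (L : Submodule R M) (n : ℤ) : AddSubgroup (M ⧸ L) :=
  (ℳ n).map L.mkQ.toAddMonoidHom

/-- A projective resolution `P` of `X` is graded by the families `𝒬 j`: each term is a graded
`R`-module, and the differentials and the augmentation are homogeneous of degree `0`. -/
structure IsGradedResolution (𝒜 : ℕ → AddSubgroup R) {X : Type u} [AddCommGroup X] [Module R X]
    (𝒳 : ℤ → AddSubgroup X) (P : ProjectiveResolution (ModuleCat.of R X))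
    (𝒬 : ∀ j : ℕ, ℤ → AddSubgroup (P.complex.X j)) : Prop where
  graded : ∀ j, IsGradedModule 𝒜 (𝒬 j)
  differential : ∀ j k, IsHomogeneousOfDegree (𝒬 j) (𝒬 k) 0
    (P.complex.d j k).hom.toAddMonoidHom
  augmentation : IsHomogeneousOfDegree (𝒬 0) 𝒳 0
    (P.π.f 0 ≫
      (HomologicalComplex.singleObjXSelf (.down ℕ) 0 (ModuleCat.of R X)).hom).hom.toAddMonoidHom

/-- The classes in `Ext^i_R(X, N)` that are represented by a cocycle `P_i → N` which is homogeneous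
of degree `n`, for one projective resolution `P` of `X` with graded terms. -/
def extDegreeOf {X N : Type u} [AddCommGroup X] [Module R X] [AddCommGroup N] [Module R N]
    (𝒩 : ℤ → AddSubgroup N) (P : ProjectiveResolution (ModuleCat.of R X))
    (𝒬 : ∀ j : ℕ, ℤ → AddSubgroup (P.complex.X j)) (i : ℕ) (n : ℤ) :
    AddSubgroup (Abelian.Ext.{u} (ModuleCat.of R X) (ModuleCat.of R N) i) where
  carrier := {e | ∃ (f : P.complex.X i ⟶ ModuleCat.of R N) (hf : P.complex.d (i + 1) i ≫ f = 0),
    IsHomogeneousOfDegree (𝒬 i) 𝒩 n f.hom.toAddMonoidHom ∧ e = P.extMk f (i + 1) rfl hf}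
  add_mem' := by
    rintro _ _ ⟨f, hf, hfn, rfl⟩ ⟨g, hg, hgn, rfl⟩
    refine ⟨f + g, by simp [hf, hg], fun m x hx => ?_, P.add_extMk f g _ rfl hf hg⟩
    exact (𝒩 (m + n)).add_mem (hfn m x hx) (hgn m x hx)
  zero_mem' := ⟨0, by simp, fun m x _ => (𝒩 (m + n)).zero_mem, (P.extMk_zero _ rfl).symm⟩
  neg_mem' := by
    rintro _ ⟨f, hf, hfn, rfl⟩
    exact ⟨-f, by simp [hf], fun m x hx => (𝒩 (m + n)).neg_mem (hfn m x hx),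
      P.neg_extMk f _ rfl hf⟩

/-- The `n`-th piece of the natural grading of `Ext^i_R(X, N)`, for graded modules `X` and `N`: the
classes of the cocycles of degree `n` on a graded projective resolution of `X`. By the comparison
theorem for graded resolutions every graded projective resolution gives the same subgroup, so the
supremum over all of them only serves to avoid choosing one. -/
def extDegree (𝒜 : ℕ → AddSubgroup R) {X N : Type u} [AddCommGroup X] [Module R X]
    [AddCommGroup N] [Module R N] (𝒳 : ℤ → AddSubgroup X) (𝒩 : ℤ → AddSubgroup N)
    (i : ℕ) (n : ℤ) : AddSubgroup (Abelian.Ext.{u} (ModuleCat.of R X) (ModuleCat.of R N) i) :=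
  ⨆ (P : ProjectiveResolution (ModuleCat.of R X))
    (𝒬 : ∀ j : ℕ, ℤ → AddSubgroup (P.complex.X j)) (_ : IsGradedResolution 𝒜 𝒳 P 𝒬),
    extDegreeOf 𝒩 P 𝒬 i n

section LocalCohomology

variable (𝔞 : Ideal R) (M N : Type u) [AddCommGroup M] [Module R M] [AddCommGroup N] [Module R N]

/-- The submodule `𝔞 ^ k M` of `M`. -/
abbrev powSMul (k : ℕ) : Submodule R M := 𝔞 ^ k • (⊤ : Submodule R M)

/-- The canonical projection `M ⧸ 𝔞 ^ l M → M ⧸ 𝔞 ^ k M` for `k ≤ l`. -/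
def quotientProj (k l : ℕ) (h : k ≤ l) :
    ModuleCat.of R (M ⧸ powSMul 𝔞 M l) ⟶ ModuleCat.of R (M ⧸ powSMul 𝔞 M k) :=
  ModuleCat.ofHom (Submodule.factor (Submodule.smul_mono_left (Ideal.pow_le_pow_right h)))

/-- The module `Ext^i_R(M ⧸ 𝔞 ^ k M, N)`. -/
abbrev extPow (i k : ℕ) : Type u :=
  Abelian.Ext.{u} (ModuleCat.of R (M ⧸ powSMul 𝔞 M k)) (ModuleCat.of R N) i

/-- The map `Ext^i_R(M ⧸ 𝔞 ^ k M, N) → Ext^i_R(M ⧸ 𝔞 ^ l M, N)` for `k ≤ l`. -/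
def extPowMap (i k l : ℕ) (h : k ≤ l) : extPow 𝔞 M N i k →ₗ[R] extPow 𝔞 M N i l :=
  (Abelian.Ext.mk₀ (quotientProj 𝔞 M k l h)).precompOfLinear R (ModuleCat.of R N) (zero_add i)

/-- The generalized local cohomology module `H^i_𝔞(M, N) = colim_k Ext^i_R(M ⧸ 𝔞 ^ k M, N)`. -/
abbrev genLocalCohomology (i : ℕ) : Type u :=
  Module.DirectLimit (extPow 𝔞 M N i) (extPowMap 𝔞 M N i)

variable {M N}

/-- The `n`-th piece of the natural grading of `H^i_𝔞(M, N)`, for graded `M` and `N` and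
homogeneous `𝔞`: the union of the images of the `n`-th pieces of the modules
`Ext^i_R(M ⧸ 𝔞 ^ k M, N)`. -/
def genLocalCohomologyDegree (𝒜 : ℕ → AddSubgroup R) (ℳ : ℤ → AddSubgroup M)
    (𝒩 : ℤ → AddSubgroup N) (i : ℕ) (n : ℤ) : AddSubgroup (genLocalCohomology 𝔞 M N i) :=
  ⨆ k : ℕ, (extDegree 𝒜 (quotientGrading ℳ (powSMul 𝔞 M k)) 𝒩 i n).map
    (Module.DirectLimit.of R ℕ (extPow 𝔞 M N i) (extPowMap 𝔞 M N i) k).toAddMonoidHom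

/-- A graded module with pieces `𝒳 n` is finitely graded if all but finitely many of its pieces
vanish. -/
def IsFinitelyGraded {X : Type u} [AddCommGroup X] (𝒳 : ℤ → AddSubgroup X) : Prop :=
  {n : ℤ | 𝒳 n ≠ ⊥}.Finite

/-- `υ_𝔞(M, N)`, the supremum in `ℕ ∪ {∞}` of all `k` such that `H^i_𝔞(M, N)` is finitely graded
for all `i < k`. -/
def upsilon (𝒜 : ℕ → AddSubgroup R) (ℳ : ℤ → AddSubgroup M) (𝒩 : ℤ → AddSubgroup N) : ℕ∞ :=
  sSup ((fun k : ℕ => (k : ℕ∞)) ''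
    {k | ∀ i < k, IsFinitelyGraded (genLocalCohomologyDegree 𝔞 𝒜 ℳ 𝒩 i)})

variable (M N)

/-- The `𝔟`-finiteness dimension `f_𝔞^𝔟(M, N)`, the supremum in `ℕ ∪ {∞}` of all `k` such that
`𝔟 ⊆ √(0 :_R H^i_𝔞(M, N))` for all `i < k`. -/
def finitenessDimension (𝔟 : Ideal R) : ℕ∞ :=
  sSup ((fun k : ℕ => (k : ℕ∞)) ''
    {k | ∀ i < k, 𝔟 ≤ (Module.annihilator R (genLocalCohomology 𝔞 M N i)).radical})

end LocalCohomology

end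

end GradedGLC

/-!
Write `H^i(N)` for `H^i_𝔞(M, N)` and `R_+` for the irrelevant ideal. For each `i` two conditions on
the modules `H^j(N)`, `j ≤ i`, are compared: being finitely graded and being killed by a power of
`R_+`; the equality of the two suprema is an equality of the sets over which they are taken.

A finitely graded `H^i(N)` is killed by a power of `R_+`, because its pieces span it and, `R` being
standard graded, `R_+ ^ t` is spanned by elements of degree `t`
(`ResolutionSystem.exists_irrelevant_pow_le_annihilator`).

The converse is an induction on `i` over all finitely generated graded `N`
(`ResolutionSystem.eventually_vanishesInDegree_of_le_annihilator`). Suppose `R_+ ^ t` kills `H^i(N)`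
and is generated by `g_1, …, g_r` of degree `t`. The map `N → N(t)^r`, `x ↦ (g_s x)_s`, has a kernel
`Γ` killed by `R_+ ^ t`, hence concentrated in finitely many degrees, and a cokernel `C`. The
long exact sequences of `Γ → N → N/Γ` and `N/Γ → N(t)^r → C` show that powers of `R_+` kill
`H^j(C)` for `j < i`, so that `H^{i-1}(C)` is finitely graded by induction. Since
`H^i(N) → H^i(N(t)^r)` is zero, the image of `H^i(N)` in `H^i(N/Γ)` comes from `H^{i-1}(C)` and the
rest of `H^i(N)` from `H^i(Γ)`.

What remains is that `H^i(N)` is finitely graded for all `i` when `N` lives in finitely many degrees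
(`ResolutionSystem.eventually_cofinite_vanishesInDegree`). In high degrees there are no cochains. In
low degrees one filters by degree, so that `N` is in a single degree and killed by `R_+`, and
embeds `N` into a power `J` of the character module of `R/R_+`, in order to shift dimensions; only
the vanishing of `H^i(J)` in low degrees is left. There, a cocycle on a resolution of `M/𝔞^k M`
becomes zero on a resolution of `M` by finitely generated modules, and the classes in
`Ext^i(M/𝔞^k M, J)` that vanish in `Ext^i(M, J)` die in the limit. The latter is
`exists_extPowMap_eq_zero`, which reduces by duality to the Artin–Rees lemma for `M ⊗ G`, with `G`
finitely generated and free.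

The grading is handled through cocycles on graded free resolutions (`ResolutionSystem`), which
compute the pieces of `H^i(N)` by `ResolutionSystem.genLocalCohomologyDegree_eq_bot_iff`.
-/

namespace GradedGLC

noncomputable section

variable {R : Type u} [CommRing R]

/-! ### Homogeneous components -/

/-- The decomposition of a group into the pieces of an internal direct sum. -/
def decomposition {M : Type u} [AddCommGroup M] {ℳ : ℤ → AddSubgroup M}
    (h : DirectSum.IsInternal ℳ) : M ≃+ DirectSum ℤ fun i => ℳ i :=
  (AddEquiv.ofBijective (DirectSum.coeAddMonoidHom ℳ) (show Function.Bijective _ from h)).symm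

/-- The projection of an internal direct sum of subgroups onto its `n`-th piece, as an
endomorphism of the whole group. -/
def component {M : Type u} [AddCommGroup M] {ℳ : ℤ → AddSubgroup M}
    (h : DirectSum.IsInternal ℳ) (n : ℤ) : M →+ M :=
  (ℳ n).subtype.comp ((DFinsupp.evalAddMonoidHom n : (DirectSum ℤ fun i => ℳ i) →+ ℳ n).comp
    (decomposition h).toAddMonoidHom)

section Additive

variable {M N : Type u} [AddCommGroup M] [AddCommGroup N]
  {ℳ : ℤ → AddSubgroup M} {𝒩 : ℤ → AddSubgroup N}

lemma component_mem (h : DirectSum.IsInternal ℳ) (n : ℤ) (x : M) : component h n x ∈ ℳ n :=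
  SetLike.coe_mem _

lemma decomposition_of_mem (h : DirectSum.IsInternal ℳ) {n : ℤ} {x : M} (hx : x ∈ ℳ n) :
    decomposition h x = DirectSum.of (fun i => ℳ i) n ⟨x, hx⟩ := by
  rw [decomposition, AddEquiv.symm_apply_eq]
  exact (DirectSum.coeAddMonoidHom_of ℳ n ⟨x, hx⟩).symm

lemma component_apply (h : DirectSum.IsInternal ℳ) (n : ℤ) (x : M) :
    component h n x = (decomposition h x n : M) :=
  rfl

lemma component_of_mem (h : DirectSum.IsInternal ℳ) {n : ℤ} {x : M} (hx : x ∈ ℳ n) :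
    component h n x = x := by
  rw [component_apply, decomposition_of_mem h hx, DirectSum.of_eq_same]

lemma component_of_mem_ne (h : DirectSum.IsInternal ℳ) {m n : ℤ} {x : M} (hx : x ∈ ℳ m)
    (hmn : m ≠ n) : component h n x = 0 := by
  rw [component_apply, decomposition_of_mem h hx, DirectSum.of_eq_of_ne _ _ _ hmn.symm,
    ZeroMemClass.coe_zero]

lemma exists_sum_component (h : DirectSum.IsInternal ℳ) (x : M) :
    ∃ s : Finset ℤ, x = ∑ n ∈ s, component h n x := by
  classical
  obtain ⟨y, rfl⟩ := (decomposition h).symm.surjective x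
  refine ⟨DFinsupp.support y, ?_⟩
  simp_rw [component_apply, AddEquiv.apply_symm_apply]
  exact DirectSum.coeAddMonoidHom_eq_dfinsuppSum ℳ y

/-- Homogeneous elements generate: a property of elements that is additive holds everywhere once
it holds for the homogeneous elements. -/
lemma homogeneous_induction (h : DirectSum.IsInternal ℳ) {p : M → Prop} (zero : p 0)
    (add : ∀ x y, p x → p y → p (x + y)) (mem : ∀ n, ∀ x ∈ ℳ n, p x) (x : M) : p x := by
  obtain ⟨s, hs⟩ := exists_sum_component h x
  rw [hs]
  exact Finset.sum_induction _ p add zero fun n _ => mem n _ (component_mem h n x)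

lemma addHom_ext_of_homogeneous (h : DirectSum.IsInternal ℳ) {f g : M →+ N}
    (hfg : ∀ n, ∀ x ∈ ℳ n, f x = g x) : f = g := by
  ext x
  exact homogeneous_induction h (p := fun x => f x = g x) (by simp)
    (fun x y hx hy => by simp [hx, hy]) hfg x

lemma component_map_of_isHomogeneousOfDegree (h : DirectSum.IsInternal ℳ)
    (h' : DirectSum.IsInternal 𝒩) {d : ℤ} {f : M →+ N} (hf : IsHomogeneousOfDegree ℳ 𝒩 d f)
    (n : ℤ) (x : M) : component h' (n + d) (f x) = f (component h n x) := by
  refine homogeneous_induction h (p := fun x => component h' (n + d) (f x) = f (component h n x))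
    (by simp) (fun x y hx hy => by simp [hx, hy]) (fun m x hx => ?_) x
  by_cases hmn : m = n
  · subst hmn
    rw [component_of_mem h hx, component_of_mem h' (hf m x hx)]
  · rw [component_of_mem_ne h hx hmn, component_of_mem_ne h' (hf m x hx) (by simpa using hmn),
      map_zero]

/-- A family of subgroups that spans and admits projections is an internal direct sum. -/
lemma isInternal_of_projections (π : ℤ → M →+ M) (same : ∀ n, ∀ x ∈ ℳ n, π n x = x)
    (ne : ∀ m n, m ≠ n → ∀ x ∈ ℳ m, π n x = 0) (top : ⨆ n, ℳ n = ⊤) :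
    DirectSum.IsInternal ℳ := by
  constructor
  · rw [injective_iff_map_eq_zero]
    intro y hy
    have key : ∀ (n : ℤ) (y : DirectSum ℤ fun i => ℳ i),
        π n (DirectSum.coeAddMonoidHom ℳ y) = (y n : M) := by
      intro n y
      induction y using DirectSum.induction_on with
      | zero => simp
      | of m x =>
        by_cases hmn : m = n
        · subst hmn
          simp [same m x x.2]
        · simp [ne m n hmn x x.2, DirectSum.of_eq_of_ne _ _ _ (Ne.symm hmn)]
      | add x y hx hy => simp [hx, hy]
    ext n
    rw [← key, hy]
    simp
  · rw [← AddMonoidHom.range_eq_top, ← top_le_iff, ← top]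
    refine iSup_le fun n x hx => ⟨DirectSum.of (fun i => ℳ i) n ⟨x, hx⟩, by simp⟩

lemma iSup_eq_top_of_isInternal (h : DirectSum.IsInternal ℳ) : ⨆ n, ℳ n = ⊤ := by
  rw [← top_le_iff]
  intro x _
  exact homogeneous_induction h (p := fun x => x ∈ ⨆ n, ℳ n) (zero_mem _)
    (fun _ _ => add_mem) (fun n x hx => AddSubgroup.mem_iSup_of_mem n hx) x

lemma IsHomogeneousOfDegree.comp {P : Type u} [AddCommGroup P] {𝒬 : ℤ → AddSubgroup P}
    {d e : ℤ} {g : N →+ P} {f : M →+ N} (hg : IsHomogeneousOfDegree 𝒩 𝒬 e g)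
    (hf : IsHomogeneousOfDegree ℳ 𝒩 d f) : IsHomogeneousOfDegree ℳ 𝒬 (d + e) (g.comp f) :=
  fun n x hx => by
    rw [← add_assoc]
    exact hg _ _ (hf n x hx)

end Additive

/-! ### Graded modules and homogeneous parts of linear maps -/

section Module

variable {𝒜 : ℕ → AddSubgroup R} {M N P : Type u} [AddCommGroup M] [AddCommGroup N]
  [AddCommGroup P] [Module R M] [Module R N] [Module R P]
  {ℳ : ℤ → AddSubgroup M} {𝒩 : ℤ → AddSubgroup N} {𝒬 : ℤ → AddSubgroup P}

lemma IsGradedModule.component_smul (hℳ : IsGradedModule 𝒜 ℳ) {j : ℕ} {a : R} (ha : a ∈ 𝒜 j)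
    (n : ℤ) (x : M) :
    component hℳ.isInternal (n + j) (a • x) = a • component hℳ.isInternal n x := by
  refine component_map_of_isHomogeneousOfDegree (f := DistribSMul.toAddMonoidHom M a)
    hℳ.isInternal hℳ.isInternal (fun m x hx => ?_) n x
  rw [add_comm]
  exact hℳ.smul_mem j m a x ha hx

lemma linearMap_ext_of_homogeneous (hℳ : IsGradedModule 𝒜 ℳ) {f g : M →ₗ[R] N}
    (hfg : ∀ n, ∀ x ∈ ℳ n, f x = g x) : f = g := by
  ext x
  exact DFunLike.congr_fun (addHom_ext_of_homogeneous hℳ.isInternal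
    (f := f.toAddMonoidHom) (g := g.toAddMonoidHom) hfg) x

/-- A finitely generated graded module is generated by finitely many homogeneous elements. -/
lemma exists_homogeneous_generators (hℳ : IsGradedModule 𝒜 ℳ) [Module.Finite R M] :
    ∃ (n : ℕ) (e : Fin n → ℤ) (g : Fin n → M), (∀ i, g i ∈ ℳ (e i)) ∧ (∀ i, g i ≠ 0) ∧
      Submodule.span R (Set.range g) = ⊤ := by
  classical
  let H : Set M := {x | x ≠ 0 ∧ ∃ n, x ∈ ℳ n}
  have hH : Submodule.span R H = ⊤ := by
    rw [← top_le_iff]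
    intro x _
    refine homogeneous_induction hℳ.isInternal (p := fun x => x ∈ Submodule.span R H)
      (zero_mem _) (fun _ _ => add_mem) (fun n x hx => ?_) x
    by_cases h0 : x = 0
    · simp [h0]
    · exact Submodule.subset_span ⟨h0, n, hx⟩
  obtain ⟨t, htH, ht⟩ := Submodule.fg_span_iff_fg_span_finset_subset H |>.1
    (hH ▸ Module.Finite.fg_top)
  choose e he using fun i : t => (htH i.2).2
  let σ := t.equivFin
  refine ⟨t.card, fun i => e (σ.symm i), fun i => σ.symm i, fun i => he _,
    fun i => (htH (σ.symm i).2).1, ?_⟩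
  rw [← hH, ht]
  congr 1
  ext x
  simp only [Set.mem_range, Finset.mem_coe]
  exact ⟨fun ⟨i, hi⟩ => hi ▸ (σ.symm i).2, fun hx => ⟨σ ⟨x, hx⟩, by simp⟩⟩

variable [GradedRing 𝒜]

variable (𝒜) in
/-- Linearity need only be checked on homogeneous scalars and homogeneous elements. -/
lemma map_smul_of_homogeneous (hℳ : IsGradedModule 𝒜 ℳ) (f : M →+ N)
    (hf : ∀ (j : ℕ) (a : R) (n : ℤ) (x : M), a ∈ 𝒜 j → x ∈ ℳ n → f (a • x) = a • f x)
    (a : R) (x : M) : f (a • x) = a • f x := by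
  refine DirectSum.Decomposition.inductionOn 𝒜 (motive := fun a => f (a • x) = a • f x)
    (by simp) (fun {j} a => ?_) (fun a b ha hb => by simp [add_smul, ha, hb]) a
  exact homogeneous_induction hℳ.isInternal (p := fun x => f ((a : R) • x) = (a : R) • f x)
    (by simp) (fun x y hx hy => by simp [hx, hy]) (fun n x hx => hf j a n x a.2 hx) x

/-- The homogeneous part of degree `n` of a linear map `f` between graded modules: on the `m`-th
piece it is the component of `f` in degree `m + n`. -/
def degPart (hℳ : IsGradedModule 𝒜 ℳ) (h𝒩 : IsGradedModule 𝒜 𝒩) (n : ℤ) (f : M →ₗ[R] N) :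
    M →ₗ[R] N :=
  let F : M →+ N := (DirectSum.toAddMonoid fun m =>
    ((component h𝒩.isInternal (m + n)).comp f.toAddMonoidHom).comp (ℳ m).subtype).comp
      (decomposition hℳ.isInternal).toAddMonoidHom
  have hF : ∀ (m : ℤ) (x : M), x ∈ ℳ m → F x = component h𝒩.isInternal (m + n) (f x) :=
    fun m x hx => by simp [F, decomposition_of_mem hℳ.isInternal hx]
  { F with
    map_smul' := map_smul_of_homogeneous 𝒜 hℳ F fun j a m x ha hx => by
      rw [hF _ _ (hℳ.smul_mem j m a x ha hx), hF m x hx, map_smul,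
        ← h𝒩.component_smul ha, add_comm (j : ℤ) m, add_right_comm] }

lemma degPart_of_mem (hℳ : IsGradedModule 𝒜 ℳ) (h𝒩 : IsGradedModule 𝒜 𝒩) (n : ℤ)
    (f : M →ₗ[R] N) {m : ℤ} {x : M} (hx : x ∈ ℳ m) :
    degPart hℳ h𝒩 n f x = component h𝒩.isInternal (m + n) (f x) := by
  change (DirectSum.toAddMonoid fun m =>
    ((component h𝒩.isInternal (m + n)).comp f.toAddMonoidHom).comp (ℳ m).subtype)
      (decomposition hℳ.isInternal x) = _
  simp [decomposition_of_mem hℳ.isInternal hx]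

lemma isHomogeneousOfDegree_degPart (hℳ : IsGradedModule 𝒜 ℳ) (h𝒩 : IsGradedModule 𝒜 𝒩) (n : ℤ)
    (f : M →ₗ[R] N) :
    IsHomogeneousOfDegree ℳ 𝒩 n (degPart hℳ h𝒩 n f).toAddMonoidHom := fun m x hx => by
  change degPart hℳ h𝒩 n f x ∈ _
  rw [degPart_of_mem hℳ h𝒩 n f hx]
  exact component_mem _ _ _

lemma degPart_eq_self (hℳ : IsGradedModule 𝒜 ℳ) (h𝒩 : IsGradedModule 𝒜 𝒩) {n : ℤ}
    {f : M →ₗ[R] N} (hf : IsHomogeneousOfDegree ℳ 𝒩 n f.toAddMonoidHom) :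
    degPart hℳ h𝒩 n f = f := by
  refine linearMap_ext_of_homogeneous hℳ fun m x hx => ?_
  rw [degPart_of_mem hℳ h𝒩 n f hx]
  exact component_of_mem h𝒩.isInternal (hf m x hx)

lemma degPart_zero (hℳ : IsGradedModule 𝒜 ℳ) (h𝒩 : IsGradedModule 𝒜 𝒩) (n : ℤ) :
    degPart hℳ h𝒩 n 0 = 0 := by
  refine linearMap_ext_of_homogeneous hℳ fun m x hx => ?_
  simp [degPart_of_mem hℳ h𝒩 n _ hx]

lemma degPart_sub (hℳ : IsGradedModule 𝒜 ℳ) (h𝒩 : IsGradedModule 𝒜 𝒩) (n : ℤ)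
    (f g : M →ₗ[R] N) :
    degPart hℳ h𝒩 n (f - g) = degPart hℳ h𝒩 n f - degPart hℳ h𝒩 n g := by
  refine linearMap_ext_of_homogeneous hℳ fun m x hx => ?_
  simp [degPart_of_mem hℳ h𝒩 n _ hx]

lemma degPart_comp_right (hℳ : IsGradedModule 𝒜 ℳ) (h𝒩 : IsGradedModule 𝒜 𝒩)
    (h𝒬 : IsGradedModule 𝒜 𝒬) {n : ℤ} (f : N →ₗ[R] P) {g : M →ₗ[R] N}
    (hg : IsHomogeneousOfDegree ℳ 𝒩 0 g.toAddMonoidHom) :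
    degPart hℳ h𝒬 n (f ∘ₗ g) = degPart h𝒩 h𝒬 n f ∘ₗ g := by
  refine linearMap_ext_of_homogeneous hℳ fun m x hx => ?_
  have : g x ∈ 𝒩 m := by simpa using hg m x hx
  simp [degPart_of_mem hℳ h𝒬 n _ hx, degPart_of_mem h𝒩 h𝒬 n _ this]

lemma degPart_comp_left (hℳ : IsGradedModule 𝒜 ℳ) (h𝒩 : IsGradedModule 𝒜 𝒩)
    (h𝒬 : IsGradedModule 𝒜 𝒬) {n : ℤ} {f : N →ₗ[R] P} (g : M →ₗ[R] N)
    (hf : IsHomogeneousOfDegree 𝒩 𝒬 0 f.toAddMonoidHom) :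
    degPart hℳ h𝒬 n (f ∘ₗ g) = f ∘ₗ degPart hℳ h𝒩 n g := by
  refine linearMap_ext_of_homogeneous hℳ fun m x hx => ?_
  have := component_map_of_isHomogeneousOfDegree h𝒩.isInternal h𝒬.isInternal hf (m + n) (g x)
  simp only [add_zero] at this
  simpa [degPart_of_mem hℳ h𝒬 n _ hx, degPart_of_mem hℳ h𝒩 n _ hx] using this

/-- A linear map on a finitely generated graded module is the sum of finitely many of its
homogeneous parts. -/
lemma exists_sum_degPart (hℳ : IsGradedModule 𝒜 ℳ) (h𝒩 : IsGradedModule 𝒜 𝒩)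
    [Module.Finite R M] (f : M →ₗ[R] N) :
    ∃ s : Finset ℤ, f = ∑ n ∈ s, degPart hℳ h𝒩 n f := by
  classical
  obtain ⟨k, e, g, hg, -, hspan⟩ := exists_homogeneous_generators hℳ
  choose t ht using fun i => exists_sum_component h𝒩.isInternal (f (g i))
  refine ⟨Finset.univ.biUnion fun i => (t i).image (fun m => m - e i), ?_⟩
  refine LinearMap.ext_on_range hspan fun i => ?_
  set s := Finset.univ.biUnion fun i => (t i).image (fun m => m - e i)
  rw [LinearMap.sum_apply]
  simp_rw [degPart_of_mem hℳ h𝒩 _ f (hg i)]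
  have hsub : t i ⊆ s.image (fun m => e i + m) := by
    intro m hm
    exact Finset.mem_image.2 ⟨m - e i, Finset.mem_biUnion.2
      ⟨i, Finset.mem_univ _, Finset.mem_image_of_mem _ hm⟩, by ring⟩
  have hzero : ∀ m ∉ t i, component h𝒩.isInternal m (f (g i)) = 0 := by
    intro m hm
    rw [ht i, map_sum]
    exact Finset.sum_eq_zero fun l hl => component_of_mem_ne _ (component_mem _ _ _)
      (fun h => hm (h ▸ hl))
  rw [ht i, ← Finset.sum_image (f := fun m => component h𝒩.isInternal m
    (∑ n ∈ t i, component h𝒩.isInternal n (f (g i)))) (s := s) (g := fun m => e i + m)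
    (fun a _ b _ h => by simpa using h), ← ht i]
  nth_rewrite 1 [ht i]
  exact Finset.sum_subset hsub fun m _ hm => hzero m hm

end Module

/-! ### Constructions of graded modules -/

section Constructions

variable {𝒜 : ℕ → AddSubgroup R} {M N : Type u} [AddCommGroup M] [AddCommGroup N]
  [Module R M] [Module R N] {ℳ : ℤ → AddSubgroup M} {𝒩 : ℤ → AddSubgroup N}

/-- A submodule of a graded module is homogeneous if it contains the homogeneous components of its
elements. -/
def IsHomogeneousSubmodule (hℳ : IsGradedModule 𝒜 ℳ) (K : Submodule R M) : Prop :=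
  ∀ (n : ℤ), ∀ x ∈ K, component hℳ.isInternal n x ∈ K

/-- The pieces of the grading induced on a submodule. -/
def subGrading (ℳ : ℤ → AddSubgroup M) (K : Submodule R M) (n : ℤ) : AddSubgroup K :=
  (ℳ n).comap K.subtype.toAddMonoidHom

lemma isGradedModule_subGrading (hℳ : IsGradedModule 𝒜 ℳ) {K : Submodule R M}
    (hK : IsHomogeneousSubmodule hℳ K) : IsGradedModule 𝒜 (subGrading ℳ K) where
  isInternal := by
    refine isInternal_of_projections
      (fun n => { toFun := fun x => ⟨component hℳ.isInternal n x, hK n x x.2⟩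
                  map_zero' := by ext; simp
                  map_add' := fun x y => by ext; simp }) ?_ ?_ ?_
    · intro n x hx
      exact Subtype.ext (component_of_mem hℳ.isInternal hx)
    · intro m n hmn x hx
      exact Subtype.ext (component_of_mem_ne hℳ.isInternal hx hmn)
    · rw [← top_le_iff]
      intro x _
      obtain ⟨s, hs⟩ := exists_sum_component hℳ.isInternal (x : M)
      have : x = ∑ n ∈ s, (⟨component hℳ.isInternal n x, hK n x x.2⟩ : K) := by
        ext
        simpa using hs
      rw [this]
      exact sum_mem fun n _ => AddSubgroup.mem_iSup_of_mem n (component_mem hℳ.isInternal n _)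
  smul_mem m n a x ha hx := hℳ.smul_mem m n a x ha hx

lemma isGradedModule_quotientGrading (hℳ : IsGradedModule 𝒜 ℳ) {K : Submodule R M}
    (hK : IsHomogeneousSubmodule hℳ K) : IsGradedModule 𝒜 (quotientGrading ℳ K) where
  isInternal := by
    refine isInternal_of_projections
      (fun n => QuotientAddGroup.map K.toAddSubgroup K.toAddSubgroup (component hℳ.isInternal n)
        fun x hx => hK n x hx) ?_ ?_ ?_
    · rintro n _ ⟨x, hx, rfl⟩
      exact congrArg K.mkQ (component_of_mem hℳ.isInternal hx)
    · rintro m n hmn _ ⟨x, hx, rfl⟩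
      exact (congrArg K.mkQ (component_of_mem_ne hℳ.isInternal hx hmn)).trans (map_zero _)
    · rw [← top_le_iff]
      intro x _
      obtain ⟨x, rfl⟩ := K.mkQ_surjective x
      exact homogeneous_induction hℳ.isInternal
        (p := fun x => K.mkQ x ∈ ⨆ n, quotientGrading ℳ K n) (by simp)
        (fun x y hx hy => by simpa using add_mem hx hy)
        (fun n x hx => AddSubgroup.mem_iSup_of_mem n ⟨x, hx, rfl⟩) x
  smul_mem := by
    rintro m n a _ ha ⟨x, hx, rfl⟩
    exact ⟨a • x, hℳ.smul_mem m n a x ha hx, rfl⟩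

lemma quotientGrading_eq_bot {K : Submodule R M} {n : ℤ} (h : ℳ n = ⊥) :
    quotientGrading ℳ K n = ⊥ := by
  rw [quotientGrading, h, AddSubgroup.map_bot]

lemma subGrading_eq_bot {K : Submodule R M} {n : ℤ} (h : ℳ n = ⊥) :
    subGrading ℳ K n = ⊥ := by
  rw [subGrading, h, eq_bot_iff]
  intro x hx
  exact Subtype.ext hx

lemma isHomogeneousOfDegree_mkQ (K : Submodule R M) :
    IsHomogeneousOfDegree ℳ (quotientGrading ℳ K) 0 K.mkQ.toAddMonoidHom := fun n x hx => by
  rw [add_zero]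
  exact ⟨x, hx, rfl⟩

lemma isHomogeneousOfDegree_subtype (K : Submodule R M) :
    IsHomogeneousOfDegree (subGrading ℳ K) ℳ 0 K.subtype.toAddMonoidHom := fun n x hx => by
  rw [add_zero]
  exact hx

lemma isHomogeneousSubmodule_ker (hℳ : IsGradedModule 𝒜 ℳ) (h𝒩 : IsGradedModule 𝒜 𝒩) {d : ℤ}
    {f : M →ₗ[R] N} (hf : IsHomogeneousOfDegree ℳ 𝒩 d f.toAddMonoidHom) :
    IsHomogeneousSubmodule hℳ (LinearMap.ker f) := fun n x hx => by
  have := component_map_of_isHomogeneousOfDegree hℳ.isInternal h𝒩.isInternal hf n x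
  rw [LinearMap.mem_ker] at hx ⊢
  exact this.symm.trans ((congrArg _ hx).trans (map_zero _))

lemma isHomogeneousSubmodule_range (hℳ : IsGradedModule 𝒜 ℳ) (h𝒩 : IsGradedModule 𝒜 𝒩) {d : ℤ}
    {f : M →ₗ[R] N} (hf : IsHomogeneousOfDegree ℳ 𝒩 d f.toAddMonoidHom) :
    IsHomogeneousSubmodule h𝒩 (LinearMap.range f) := by
  rintro n _ ⟨x, rfl⟩
  have := component_map_of_isHomogeneousOfDegree hℳ.isInternal h𝒩.isInternal hf (n - d) x
  rw [sub_add_cancel] at this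
  exact ⟨component hℳ.isInternal (n - d) x, this.symm⟩

lemma isGradedModule_shift (hℳ : IsGradedModule 𝒜 ℳ) (d : ℤ) :
    IsGradedModule 𝒜 (fun n => ℳ (n + d)) where
  isInternal := by
    refine isInternal_of_projections (fun n => component hℳ.isInternal (n + d))
      (fun n x hx => component_of_mem _ hx)
      (fun m n hmn x hx => component_of_mem_ne _ hx (by simpa using hmn)) ?_
    rw [← iSup_eq_top_of_isInternal hℳ.isInternal]
    exact (Equiv.addRight d).iSup_comp (g := ℳ)
  smul_mem m n a x ha hx := by
    rw [add_assoc]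
    exact hℳ.smul_mem m (n + d) a x ha hx

/-- The componentwise grading of a power of a module, where each factor carries its own
grading. -/
def piGrading {ι : Type} (ℳ : ι → ℤ → AddSubgroup M) (n : ℤ) : AddSubgroup (ι → M) :=
  AddSubgroup.pi Set.univ fun i => ℳ i n

lemma mem_piGrading {ι : Type} {ℳ : ι → ℤ → AddSubgroup M} {n : ℤ} {v : ι → M} :
    v ∈ piGrading ℳ n ↔ ∀ i, v i ∈ ℳ i n := by
  simp [piGrading, AddSubgroup.mem_pi]

lemma isGradedModule_piGrading {ι : Type} [Finite ι] {ℳ : ι → ℤ → AddSubgroup M}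
    (hℳ : ∀ i, IsGradedModule 𝒜 (ℳ i)) : IsGradedModule 𝒜 (piGrading ℳ) where
  isInternal := by
    classical
    have := Fintype.ofFinite ι
    refine isInternal_of_projections
      (fun n => { toFun := fun v i => component (hℳ i).isInternal n (v i)
                  map_zero' := by ext; simp
                  map_add' := fun x y => by ext; simp }) ?_ ?_ ?_
    · intro n v hv
      ext i
      exact component_of_mem _ (mem_piGrading.1 hv i)
    · intro m n hmn v hv
      ext i
      exact component_of_mem_ne _ (mem_piGrading.1 hv i) hmn
    · rw [← top_le_iff]
      intro v _
      rw [← Finset.univ_sum_single v]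
      refine sum_mem fun i _ => ?_
      refine homogeneous_induction (hℳ i).isInternal
        (p := fun x => (Pi.single i x : ι → M) ∈ ⨆ n, piGrading ℳ n) (by simp)
        (fun x y hx hy => by simpa only [Pi.single_add] using add_mem hx hy) (fun n x hx => ?_)
        (v i)
      refine AddSubgroup.mem_iSup_of_mem n (mem_piGrading.2 fun j => ?_)
      by_cases hij : j = i
      · subst hij
        simpa using hx
      · simp [hij, zero_mem]
  smul_mem m n a v ha hv := mem_piGrading.2 fun i =>
    (hℳ i).smul_mem m n a (v i) ha (mem_piGrading.1 hv i)

/-- The grading of `M` in which every element has degree `c`. -/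
def concentratedGrading (M : Type u) [AddCommGroup M] (c n : ℤ) : AddSubgroup M :=
  if n = c then ⊤ else ⊥

lemma concentratedGrading_of_ne {c n : ℤ} (h : n ≠ c) : concentratedGrading M c n = ⊥ :=
  if_neg h

lemma isGradedModule_concentratedGrading (c : ℤ)
    (hM : ∀ (j : ℕ), 0 < j → ∀ a ∈ 𝒜 j, ∀ x : M, a • x = 0) :
    IsGradedModule 𝒜 (concentratedGrading M c) where
  isInternal := by
    refine isInternal_of_projections (fun n => if n = c then AddMonoidHom.id M else 0) ?_ ?_ ?_
    · intro n x hx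
      by_cases h : n = c
      · simp [h]
      · rw [concentratedGrading_of_ne h, AddSubgroup.mem_bot] at hx
        simp [hx]
    · intro m n hmn x hx
      by_cases h : n = c
      · rw [concentratedGrading_of_ne (h ▸ hmn), AddSubgroup.mem_bot] at hx
        simp [hx]
      · simp [h]
    · rw [← top_le_iff]
      exact le_iSup_of_le c (by simp [concentratedGrading])
  smul_mem m n a x ha hx := by
    by_cases h : n = c
    · rcases Nat.eq_zero_or_pos m with rfl | hm
      · simp [concentratedGrading, h]
      · rw [hM m hm a ha x]
        exact zero_mem _
    · rw [concentratedGrading_of_ne h, AddSubgroup.mem_bot] at hx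
      rw [hx, smul_zero]
      exact zero_mem _

/-- The grading of `R`, extended by zero to negative degrees. -/
def intGrading (𝒜 : ℕ → AddSubgroup R) : ℤ → AddSubgroup R
  | Int.ofNat j => 𝒜 j
  | Int.negSucc _ => ⊥

lemma isGradedModule_intGrading (𝒜 : ℕ → AddSubgroup R) [GradedRing 𝒜] :
    IsGradedModule 𝒜 (intGrading 𝒜) where
  isInternal := by
    refine isInternal_of_projections (fun n => match n with
      | Int.ofNat j => GradedRing.proj 𝒜 j
      | Int.negSucc _ => 0) ?_ ?_ ?_
    · rintro (j | j) x hx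
      · exact DirectSum.decompose_of_mem_same 𝒜 hx
      · exact (AddSubgroup.mem_bot.1 hx).symm
    · rintro (i | i) (j | j) hij x hx
      · exact DirectSum.decompose_of_mem_ne 𝒜 hx (fun h => hij (congrArg Int.ofNat h))
      · rfl
      · rw [AddSubgroup.mem_bot.1 hx, map_zero]
      · rfl
    · rw [← top_le_iff]
      intro x _
      refine DirectSum.Decomposition.inductionOn 𝒜 (motive := fun x => x ∈ ⨆ n, intGrading 𝒜 n)
        (zero_mem _) (fun {j} a => ?_) (fun _ _ => add_mem) x
      exact AddSubgroup.mem_iSup_of_mem (Int.ofNat j) a.2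
  smul_mem := by
    rintro m (j | j) a x ha hx
    · have hx' : x ∈ 𝒜 j := hx
      have hax : a * x ∈ 𝒜 (m + j) := SetLike.mul_mem_graded ha hx'
      exact hax
    · rw [AddSubgroup.mem_bot.1 hx, smul_zero]
      exact zero_mem _

/-- The grading of the free module `R ^ k` whose `i`-th basis vector has degree `e i`. -/
def freeGrading (𝒜 : ℕ → AddSubgroup R) {k : ℕ} (e : Fin k → ℤ) : ℤ → AddSubgroup (Fin k → R) :=
  piGrading fun i n => intGrading 𝒜 (n + -e i)

lemma isGradedModule_freeGrading (𝒜 : ℕ → AddSubgroup R) [GradedRing 𝒜] {k : ℕ}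
    (e : Fin k → ℤ) : IsGradedModule 𝒜 (freeGrading 𝒜 e) :=
  isGradedModule_piGrading fun i => isGradedModule_shift (isGradedModule_intGrading 𝒜) (-e i)

lemma intGrading_eq_bot {n : ℤ} (hn : n < 0) : intGrading 𝒜 n = ⊥ := by
  match n, hn with
  | Int.negSucc _, _ => rfl

lemma IsGradedModule.intGrading_smul_mem (hℳ : IsGradedModule 𝒜 ℳ) {m n : ℤ} {a : R} {x : M}
    (ha : a ∈ intGrading 𝒜 m) (hx : x ∈ ℳ n) : a • x ∈ ℳ (m + n) := by
  match m, ha with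
  | Int.ofNat j, ha => exact hℳ.smul_mem j n a x ha hx
  | Int.negSucc j, ha =>
    rw [AddSubgroup.mem_bot.1 ha, zero_smul]
    exact zero_mem _

/-- Every finitely generated graded module is a homogeneous quotient of a finitely generated graded
free module, whose basis can be taken in degrees in which the module is nonzero. -/
lemma exists_graded_free_cover (hℳ : IsGradedModule 𝒜 ℳ) [Module.Finite R M] :
    ∃ (k : ℕ) (e : Fin k → ℤ) (φ : (Fin k → R) →ₗ[R] M), Function.Surjective φ ∧
      IsHomogeneousOfDegree (freeGrading 𝒜 e) ℳ 0 φ.toAddMonoidHom ∧ ∀ i, ℳ (e i) ≠ ⊥ := by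
  obtain ⟨k, e, g, hg, hg0, hspan⟩ := exists_homogeneous_generators hℳ
  refine ⟨k, e, Fintype.linearCombination R g, ?_, ?_, ?_⟩
  · rw [← LinearMap.range_eq_top, Fintype.range_linearCombination, hspan]
  · intro n v hv
    change Fintype.linearCombination R g v ∈ _
    rw [Fintype.linearCombination_apply, add_zero]
    refine sum_mem fun i _ => ?_
    have := hℳ.intGrading_smul_mem (mem_piGrading.1 hv i) (hg i)
    rwa [neg_add_cancel_right] at this
  · intro i h
    exact hg0 i (AddSubgroup.mem_bot.1 (h ▸ hg i))

lemma freeGrading_eq_bot {k : ℕ} {e : Fin k → ℤ} {n : ℤ} (h : ∀ i, n < e i) :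
    freeGrading 𝒜 e n = ⊥ := by
  rw [eq_bot_iff]
  intro v hv
  rw [AddSubgroup.mem_bot]
  ext i
  have := mem_piGrading.1 hv i
  rwa [intGrading_eq_bot (by linarith [h i]), AddSubgroup.mem_bot] at this

end Constructions

/-! ### Graded free resolutions -/

section Resolution

variable (R) in
/-- A sequence of surjections `φ j : F j → K j` from projective modules, where `ι j` identifies
`K (j + 1)` with the kernel of `φ j`; so `K (j + 1)` is a syzygy module of `K j`. -/
structure SyzygySequence where
  F : ℕ → Type u
  K : ℕ → Type u
  [addCommGroupF : ∀ j, AddCommGroup (F j)]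
  [moduleF : ∀ j, Module R (F j)]
  [addCommGroupK : ∀ j, AddCommGroup (K j)]
  [moduleK : ∀ j, Module R (K j)]
  [projective : ∀ j, Module.Projective R (F j)]
  φ : ∀ j, F j →ₗ[R] K j
  ι : ∀ j, K (j + 1) →ₗ[R] F j
  surjective : ∀ j, Function.Surjective (φ j)
  injective : ∀ j, Function.Injective (ι j)
  exact : ∀ j, Function.Exact (ι j) (φ j)

namespace SyzygySequence

attribute [instance] addCommGroupF moduleF addCommGroupK moduleK projective

variable (S : SyzygySequence R)

lemma φ_ι (j : ℕ) (x : S.K (j + 1)) : S.φ j (S.ι j x) = 0 :=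
  (S.exact j).apply_apply_eq_zero x

/-- The complex of projective modules obtained by splicing. -/
def complex : ChainComplex (ModuleCat.{u} R) ℕ :=
  ChainComplex.of (fun j => ModuleCat.of R (S.F j))
    (fun j => ModuleCat.ofHom (S.ι j ∘ₗ S.φ (j + 1))) (fun j => by
      ext x
      simp [S.φ_ι])

lemma complex_d (j : ℕ) :
    S.complex.d (j + 1) j = ModuleCat.ofHom (S.ι j ∘ₗ S.φ (j + 1)) :=
  ChainComplex.of_d (fun j => ModuleCat.of R (S.F j))
    (fun j => ModuleCat.ofHom (S.ι j ∘ₗ S.φ (j + 1))) j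

/-- The augmentation of the spliced complex. -/
def augmentation : S.complex ⟶ (ChainComplex.single₀ _).obj (ModuleCat.of R (S.K 0)) :=
  (ChainComplex.toSingle₀Equiv _ _).symm ⟨ModuleCat.ofHom (S.φ 0), by
    rw [complex_d]
    ext x
    exact S.φ_ι 0 _⟩

lemma augmentation_f_zero : S.augmentation.f 0 = ModuleCat.ofHom (S.φ 0) :=
  ChainComplex.toSingle₀Equiv_symm_apply_f_zero _ _

lemma exists_d_of_ι_φ_eq_zero (j : ℕ) (x : S.F (j + 1)) (hx : S.ι j (S.φ (j + 1) x) = 0) :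
    ∃ y : S.F (j + 2), S.ι (j + 1) (S.φ (j + 2) y) = x := by
  obtain ⟨z, rfl⟩ := (S.exact (j + 1) x).1 (S.injective j (hx.trans (map_zero _).symm))
  obtain ⟨y, rfl⟩ := S.surjective (j + 2) z
  exact ⟨y, rfl⟩

lemma exactAt_succ (j : ℕ) : S.complex.ExactAt (j + 1) := by
  rw [HomologicalComplex.exactAt_iff' _ (j + 1 + 1) (j + 1) j (by simp) (by simp),
    ShortComplex.moduleCat_exact_iff]
  intro x hx
  obtain ⟨y, hy⟩ := S.exists_d_of_ι_φ_eq_zero j x (by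
    have : (S.complex.d (j + 1) j).hom x = 0 := hx
    rwa [complex_d] at this)
  refine ⟨y, ?_⟩
  change (S.complex.d (j + 1 + 1) (j + 1)).hom y = x
  rw [complex_d]
  exact hy

lemma exact_augmentation :
    (ShortComplex.mk (S.complex.d 1 0) (ModuleCat.ofHom (S.φ 0) : S.complex.X 0 ⟶ _) (by
      rw [complex_d]
      ext x
      exact S.φ_ι 0 _)).Exact := by
  rw [ShortComplex.moduleCat_exact_iff]
  intro x hx
  obtain ⟨z, rfl⟩ := (S.exact 0 x).1 hx
  obtain ⟨y, rfl⟩ := S.surjective 1 z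
  refine ⟨y, ?_⟩
  change (S.complex.d (0 + 1) 0).hom y = _
  rw [complex_d]
  rfl

instance quasiIso_augmentation : QuasiIso S.augmentation := ⟨fun n => by
  cases n with
  | zero =>
    rw [ChainComplex.quasiIsoAt₀_iff, ShortComplex.quasiIso_iff_of_zeros']
    · refine (ShortComplex.exact_and_epi_g_iff_of_iso ?_).2 ⟨S.exact_augmentation,
        (ModuleCat.epi_iff_surjective _).2 (S.surjective 0)⟩
      exact ShortComplex.isoMk (Iso.refl _) (Iso.refl _) (Iso.refl _)
        ((Category.id_comp _).trans (Category.comp_id _).symm)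
        ((Category.id_comp _).trans (S.augmentation_f_zero.symm.trans (Category.comp_id _).symm))
    all_goals rfl
  | succ n =>
    rw [quasiIsoAt_iff_exactAt']
    · exact S.exactAt_succ n
    · apply ChainComplex.exactAt_succ_single_obj⟩

/-- The projective resolution of `K 0` obtained by splicing. -/
def resolution : ProjectiveResolution (ModuleCat.of R (S.K 0)) where
  complex := S.complex
  projective j := (inferInstance : Projective (ModuleCat.of R (S.F j)))
  π := S.augmentation

end SyzygySequence

/-- A finitely generated graded module, as a bundled object. -/
structure FinGradedModule (𝒜 : ℕ → AddSubgroup R) where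
  carrier : Type u
  [addCommGroup : AddCommGroup carrier]
  [module : Module R carrier]
  [finite : Module.Finite R carrier]
  pieces : ℤ → AddSubgroup carrier
  graded : IsGradedModule 𝒜 pieces

namespace FinGradedModule

attribute [instance] addCommGroup module finite

variable {𝒜 : ℕ → AddSubgroup R} (X : FinGradedModule 𝒜)

/-- The rank of a chosen graded free cover. -/
def coverRank : ℕ := (exists_graded_free_cover X.graded).choose

/-- The degrees of the basis of a chosen graded free cover. -/
def coverDegree : Fin X.coverRank → ℤ := (exists_graded_free_cover X.graded).choose_spec.choose

/-- A chosen graded free cover. -/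
def cover : (Fin X.coverRank → R) →ₗ[R] X.carrier :=
  (exists_graded_free_cover X.graded).choose_spec.choose_spec.choose

lemma cover_spec : Function.Surjective X.cover ∧
    IsHomogeneousOfDegree (freeGrading 𝒜 X.coverDegree) X.pieces 0 X.cover.toAddMonoidHom ∧
      ∀ i, X.pieces (X.coverDegree i) ≠ ⊥ :=
  (exists_graded_free_cover X.graded).choose_spec.choose_spec.choose_spec

variable [GradedRing 𝒜] [IsNoetherianRing R]

/-- The graded syzygy module: the kernel of the chosen graded free cover. -/
def syzygy : FinGradedModule 𝒜 where
  carrier := LinearMap.ker X.cover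
  pieces := subGrading (freeGrading 𝒜 X.coverDegree) (LinearMap.ker X.cover)
  graded := isGradedModule_subGrading (isGradedModule_freeGrading 𝒜 X.coverDegree)
    (isHomogeneousSubmodule_ker _ X.graded X.cover_spec.2.1)

/-- The iterated syzygy modules. -/
def iterSyzygy : ℕ → FinGradedModule 𝒜
  | 0 => X
  | j + 1 => (iterSyzygy j).syzygy

/-- The iterated syzygies of a finitely generated graded module form a sequence of syzygies. -/
def syzygySequence : SyzygySequence R where
  F j := Fin (X.iterSyzygy j).coverRank → R
  K j := (X.iterSyzygy j).carrier
  φ j := (X.iterSyzygy j).cover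
  ι j := (LinearMap.ker (X.iterSyzygy j).cover).subtype
  surjective _ := (X.iterSyzygy _).cover_spec.1
  injective _ := Subtype.val_injective
  exact _ := LinearMap.exact_subtype_ker_map _

lemma isHomogeneousOfDegree_d (j : ℕ) :
    IsHomogeneousOfDegree (freeGrading 𝒜 (X.iterSyzygy (j + 1)).coverDegree)
      (freeGrading 𝒜 (X.iterSyzygy j).coverDegree) 0
      (X.syzygySequence.ι j ∘ₗ X.syzygySequence.φ (j + 1)).toAddMonoidHom :=
  (isHomogeneousOfDegree_subtype _).comp (X.iterSyzygy (j + 1)).cover_spec.2.1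

lemma iterSyzygy_pieces_eq_bot {c : ℤ} (hc : ∀ m < c, X.pieces m = ⊥) (j : ℕ) :
    ∀ m < c, (X.iterSyzygy j).pieces m = ⊥ := by
  induction j with
  | zero => exact hc
  | succ j ih =>
    intro m hm
    refine subGrading_eq_bot (freeGrading_eq_bot fun i => ?_)
    by_contra! h
    exact (X.iterSyzygy j).cover_spec.2.2 i (ih _ (h.trans_lt hm))

end FinGradedModule

variable {𝒜 : ℕ → AddSubgroup R} [GradedRing 𝒜] [IsNoetherianRing R]

/-- A finitely generated graded module over a Noetherian graded ring has a graded projective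
resolution by finitely generated modules, living in degrees in which the module may be nonzero or
above. -/
lemma exists_graded_resolution {M : Type u} [AddCommGroup M] [Module R M] [Module.Finite R M]
    {ℳ : ℤ → AddSubgroup M} (hℳ : IsGradedModule 𝒜 ℳ) :
    ∃ (P : ProjectiveResolution (ModuleCat.of R M)) (𝒬 : ∀ j : ℕ, ℤ → AddSubgroup (P.complex.X j)),
      IsGradedResolution 𝒜 ℳ P 𝒬 ∧ (∀ j, Module.Finite R (P.complex.X j)) ∧
      ∀ c, (∀ m < c, ℳ m = ⊥) → ∀ j, ∀ m < c, 𝒬 j m = ⊥ := by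
  let X : FinGradedModule 𝒜 := { carrier := M, pieces := ℳ, graded := hℳ }
  refine ⟨X.syzygySequence.resolution, fun j => freeGrading 𝒜 (X.iterSyzygy j).coverDegree,
    ⟨fun j => isGradedModule_freeGrading 𝒜 _, fun j k => ?_, ?_⟩, fun j => ?_,
    fun c hc j m hm => ?_⟩
  · by_cases hjk : k + 1 = j
    · subst hjk
      have := X.isHomogeneousOfDegree_d k
      have h2 := X.syzygySequence.complex_d k
      change IsHomogeneousOfDegree _ _ 0 (X.syzygySequence.complex.d (k + 1) k).hom.toAddMonoidHom
      rw [h2]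
      exact this
    · have : X.syzygySequence.resolution.complex.d j k = 0 :=
        HomologicalComplex.shape _ _ _ hjk
      rw [this]
      intro n x _
      exact zero_mem _
  · intro n x hx
    have h1 := X.cover_spec.2.1 n x hx
    have h2 := X.syzygySequence.augmentation_f_zero
    change (X.syzygySequence.augmentation.f 0).hom x ∈ _
    rw [h2]
    exact h1
  · exact (inferInstance : Module.Finite R (Fin (X.iterSyzygy j).coverRank → R))
  · refine freeGrading_eq_bot fun i => ?_
    by_contra! h
    exact (X.iterSyzygy j).cover_spec.2.2 i (X.iterSyzygy_pieces_eq_bot hc j _ (h.trans_lt hm))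

end Resolution

/-! ### Cocycles on graded resolutions -/

section Cocycles

open Abelian

/-- The map `f : P i ⟶ Y` on a term of a projective resolution is a coboundary: it factors through
the differential, or is zero if `i = 0`. -/
def IsCoboundary {X : ModuleCat.{u} R} (P : ProjectiveResolution X) {Y : ModuleCat.{u} R} :
    ∀ {i : ℕ}, (P.complex.X i ⟶ Y) → Prop
  | 0, f => f = 0
  | j + 1, f => ∃ g : P.complex.X j ⟶ Y, P.complex.d (j + 1) j ≫ g = f

variable {X X' Y Y' : ModuleCat.{u} R} {P : ProjectiveResolution X}
  {P' : ProjectiveResolution X'} {i : ℕ}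

lemma extMk_eq_zero_iff_isCoboundary (f : P.complex.X i ⟶ Y)
    (hf : P.complex.d (i + 1) i ≫ f = 0) :
    P.extMk f (i + 1) rfl hf = 0 ↔ IsCoboundary P f := by
  cases i with
  | zero =>
    simp only [← P.extEquivCohomologyClass.apply_eq_iff_eq,
      ProjectiveResolution.extEquivCohomologyClass_extMk,
      ProjectiveResolution.extEquivCohomologyClass_zero,
      CochainComplex.HomComplex.CohomologyClass.mk_eq_zero_iff]
    rw [CochainComplex.HomComplex.Cocycle.toSingleMk_mem_coboundaries_iff _ _ _ _ _ 1 (by lia)]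
    have hzero : Limits.IsZero (P.cochainComplex.X 1) :=
      CochainComplex.isZero_of_isStrictlyLE _ 0 1 (by lia)
    constructor
    · rintro ⟨g, hg⟩
      rw [hzero.eq_of_src g 0, Limits.comp_zero] at hg
      exact (cancel_epi _).1 (hg.symm.trans Limits.comp_zero.symm)
    · intro hf0
      have hf0 : f = 0 := hf0
      exact ⟨0, by rw [hf0, Limits.comp_zero, Limits.comp_zero]⟩
  | succ j => exact P.extMk_eq_zero_iff f _ rfl hf j rfl

lemma IsCoboundary.comp {f : P.complex.X i ⟶ Y} (hf : IsCoboundary P f) (g : Y ⟶ Y') :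
    IsCoboundary P (f ≫ g) := by
  cases i with
  | zero =>
    have hf : f = 0 := hf
    exact (by rw [hf, Limits.zero_comp] : f ≫ g = 0)
  | succ j =>
    obtain ⟨h, rfl⟩ := hf
    exact ⟨h ≫ g, by simp⟩

lemma smul_extMk (r : R) (f : P.complex.X i ⟶ Y) (hf : P.complex.d (i + 1) i ≫ f = 0) :
    r • P.extMk f (i + 1) rfl hf =
      P.extMk (r • f) (i + 1) rfl (by rw [Linear.comp_smul, hf, smul_zero]) := by
  rw [Ext.smul_eq_comp_mk₀, ProjectiveResolution.extMk_comp_mk₀]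
  simp

lemma sum_extMk {ι : Type*} (s : Finset ι) (f : ι → (P.complex.X i ⟶ Y))
    (hf : ∀ a, P.complex.d (i + 1) i ≫ f a = 0) :
    ∑ a ∈ s, P.extMk (f a) (i + 1) rfl (hf a) =
      P.extMk (∑ a ∈ s, f a) (i + 1) rfl (by simp [Preadditive.comp_sum, hf]) := by
  classical
  induction s using Finset.induction_on with
  | empty => simp
  | insert a s ha ih =>
    simp_rw [Finset.sum_insert ha]
    rw [ih, P.add_extMk]

end Cocycles

section Comparison

open Abelian

variable {𝒜 : ℕ → AddSubgroup R} [GradedRing 𝒜] {X X' : Type u} [AddCommGroup X] [Module R X]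
  [AddCommGroup X'] [Module R X'] {𝒳 : ℤ → AddSubgroup X} {𝒳' : ℤ → AddSubgroup X'}
  {P : ProjectiveResolution (ModuleCat.of R X)} {𝒬 : ∀ j : ℕ, ℤ → AddSubgroup (P.complex.X j)}
  {P' : ProjectiveResolution (ModuleCat.of R X')}
  {𝒬' : ∀ j : ℕ, ℤ → AddSubgroup (P'.complex.X j)}

/-- A homogeneous map of degree zero lifts to a homogeneous map of graded resolutions: take the
parts of degree zero of the components of any lift. -/
lemma exists_homogeneous_lift (h𝒳' : IsGradedModule 𝒜 𝒳')
    (hP : IsGradedResolution 𝒜 𝒳 P 𝒬) (hP' : IsGradedResolution 𝒜 𝒳' P' 𝒬')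
    {h : X →ₗ[R] X'} (hh : IsHomogeneousOfDegree 𝒳 𝒳' 0 h.toAddMonoidHom) :
    ∃ φ : P.Hom P' (ModuleCat.ofHom h),
      ∀ j, IsHomogeneousOfDegree (𝒬 j) (𝒬' j) 0 (φ.hom.f j).hom.toAddMonoidHom := by
  let φ := ProjectiveResolution.lift (ModuleCat.ofHom h) P P'
  let ψ : P.complex ⟶ P'.complex :=
    { f := fun j => ModuleCat.ofHom (degPart (hP.graded j) (hP'.graded j) 0 (φ.f j).hom)
      comm' := fun j k _ => by
        have := congrArg ModuleCat.Hom.hom (φ.comm j k)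
        ext1
        simp only [ModuleCat.hom_comp, ModuleCat.hom_ofHom] at this ⊢
        rw [← degPart_comp_left (hP.graded j) (hP'.graded j) (hP'.graded k) _
          (hP'.differential j k), this,
          degPart_comp_right (hP.graded j) (hP.graded k) (hP'.graded k) _ (hP.differential j k)] }
  refine ⟨⟨ψ, ?_⟩, fun j =>
    isHomogeneousOfDegree_degPart (hP.graded j) (hP'.graded j) 0 (φ.f j).hom⟩
  let ε : P.complex.X 0 →ₗ[R] X := (P.π.f 0 ≫
      (HomologicalComplex.singleObjXSelf (.down ℕ) 0 (ModuleCat.of R X)).hom).hom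
  let ε' : P'.complex.X 0 →ₗ[R] X' := (P'.π.f 0 ≫
      (HomologicalComplex.singleObjXSelf (.down ℕ) 0 (ModuleCat.of R X')).hom).hom
  have hφ : ε' ∘ₗ (φ.f 0).hom = h ∘ₗ ε := by
    have h1 := HomologicalComplex.congr_hom
      (ProjectiveResolution.lift_commutes (ModuleCat.ofHom h) P P') 0
    have h2 := congrArg (fun f => f ≫
      (HomologicalComplex.singleObjXSelf (.down ℕ) 0 (ModuleCat.of R X')).hom) h1
    simp only [HomologicalComplex.comp_f, Category.assoc, ChainComplex.single₀,
      HomologicalComplex.single_map_f_self, Iso.inv_hom_id, Category.comp_id] at h2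
    exact congrArg ModuleCat.Hom.hom h2
  have hψ : ε' ∘ₗ (ψ.f 0).hom = h ∘ₗ ε := by
    change ε' ∘ₗ degPart (hP.graded 0) (hP'.graded 0) 0 (φ.f 0).hom = _
    rw [← degPart_comp_left (hP.graded 0) (hP'.graded 0) h𝒳' _ hP'.augmentation, hφ]
    exact degPart_eq_self _ _ (by
      have := hh.comp hP.augmentation
      rwa [zero_add] at this)
  rw [← cancel_mono (HomologicalComplex.singleObjXSelf (.down ℕ) 0 (ModuleCat.of R X')).hom]
  simp only [Category.assoc, ChainComplex.single₀,
      HomologicalComplex.single_map_f_self, Iso.inv_hom_id, Category.comp_id]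
  ext1
  exact hψ

variable {N : Type u} [AddCommGroup N] [Module R N] {𝒩 : ℤ → AddSubgroup N}

/-- The grading of `Ext` can be computed on any one graded resolution. -/
lemma extDegree_eq_extDegreeOf (h𝒳 : IsGradedModule 𝒜 𝒳) (hP : IsGradedResolution 𝒜 𝒳 P 𝒬)
    (i : ℕ) (n : ℤ) : extDegree 𝒜 𝒳 𝒩 i n = extDegreeOf 𝒩 P 𝒬 i n := by
  refine le_antisymm ?_ (le_iSup_of_le P (le_iSup_of_le 𝒬 (le_iSup_of_le hP le_rfl)))
  refine iSup_le fun P' => iSup_le fun 𝒬' => iSup_le fun hP' => ?_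
  rintro _ ⟨f, hf, hfn, rfl⟩
  obtain ⟨φ, hφ⟩ := exists_homogeneous_lift h𝒳 hP hP' (h := LinearMap.id)
    (fun n x hx => by rw [add_zero]; exact hx)
  have key := ProjectiveResolution.mk₀_comp_extMk f (i + 1) rfl hf φ
  refine ⟨φ.hom.f i ≫ f, by simp [← φ.hom.comm_assoc, hf], ?_,
    (Ext.mk₀_id_comp _).symm.trans key⟩
  have := hfn.comp (hφ i)
  rwa [zero_add] at this

end Comparison

/-! ### Generalized local cohomology through cocycles -/

section Lifting

variable {X : ModuleCat.{u} R} {P : ProjectiveResolution X} {N' N N'' : Type u} [AddCommGroup N']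
  [AddCommGroup N] [AddCommGroup N''] [Module R N'] [Module R N] [Module R N'']
  {ι : N' →ₗ[R] N} {q : N →ₗ[R] N''} {i : ℕ}

lemma exists_factor_of_comp_eq_zero (hι : Function.Injective ι) (hex : Function.Exact ι q)
    {Y : ModuleCat.{u} R} (f : Y ⟶ ModuleCat.of R N) (hf : f ≫ ModuleCat.ofHom q = 0) :
    ∃ f' : Y ⟶ ModuleCat.of R N', f' ≫ ModuleCat.ofHom ι = f := by
  have hrange : ∀ y, f.hom y ∈ LinearMap.range ι := fun y =>
    (hex _).1 (congrArg (fun g => g.hom y) hf)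
  refine ⟨ModuleCat.ofHom ((LinearEquiv.ofInjective ι hι).symm.toLinearMap ∘ₗ
    f.hom.codRestrict _ hrange), ?_⟩
  ext y
  have := LinearEquiv.apply_symm_apply (LinearEquiv.ofInjective ι hι) ⟨f.hom y, hrange y⟩
  exact congrArg Subtype.val this

lemma exists_lift_of_projective (hq : Function.Surjective q) {Y : ModuleCat.{u} R} [Projective Y]
    (f : Y ⟶ ModuleCat.of R N'') : ∃ g : Y ⟶ ModuleCat.of R N, g ≫ ModuleCat.ofHom q = f :=
  have := (ModuleCat.epi_iff_surjective (ModuleCat.ofHom q)).2 hq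
  ⟨Projective.factorThru f (ModuleCat.ofHom q), Projective.factorThru_comp _ _⟩

lemma eq_of_comp_injective (hι : Function.Injective ι) {Y : ModuleCat.{u} R}
    {f g : Y ⟶ ModuleCat.of R N'} (h : f ≫ ModuleCat.ofHom ι = g ≫ ModuleCat.ofHom ι) : f = g :=
  have := (ModuleCat.mono_iff_injective (ModuleCat.ofHom ι)).2 hι
  (cancel_mono _).1 h

lemma IsCoboundary.d_comp {Y : ModuleCat.{u} R} {f : P.complex.X i ⟶ Y} (hf : IsCoboundary P f) :
    P.complex.d (i + 1) i ≫ f = 0 := by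
  cases i with
  | zero =>
    have hf : f = 0 := hf
    rw [hf, Limits.comp_zero]
  | succ j =>
    obtain ⟨g, rfl⟩ := hf
    simp

/-- If the image of a cochain in the quotient is a coboundary, then up to a coboundary the cochain
takes values in the submodule. -/
lemma exists_isCoboundary_sub (hι : Function.Injective ι) (hex : Function.Exact ι q)
    (hq : Function.Surjective q) (f : P.complex.X i ⟶ ModuleCat.of R N)
    (hf : IsCoboundary P (f ≫ ModuleCat.ofHom q)) :
    ∃ f' : P.complex.X i ⟶ ModuleCat.of R N', IsCoboundary P (f - f' ≫ ModuleCat.ofHom ι) := by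
  cases i with
  | zero =>
    obtain ⟨f', hf'⟩ := exists_factor_of_comp_eq_zero hι hex f hf
    exact ⟨f', sub_eq_zero.2 hf'.symm⟩
  | succ j =>
    obtain ⟨g, hg⟩ := hf
    obtain ⟨g', rfl⟩ := exists_lift_of_projective hq g
    obtain ⟨f', hf'⟩ := exists_factor_of_comp_eq_zero hι hex (f - P.complex.d (j + 1) j ≫ g')
      (by rw [Preadditive.sub_comp, Category.assoc, hg, sub_self])
    exact ⟨f', g', by rw [hf', sub_sub_cancel]⟩

end Lifting

section System

variable {M : Type u} [AddCommGroup M] [Module R M]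

/-- For each `k` a graded projective resolution of `M ⧸ 𝔞 ^ k M` by finitely generated modules,
together with homogeneous lifts of the projections `M ⧸ 𝔞 ^ l M → M ⧸ 𝔞 ^ k M`. The lifts are not
required to be compatible with composition. -/
structure ResolutionSystem (𝒜 : ℕ → AddSubgroup R) (𝔞 : Ideal R) (ℳ : ℤ → AddSubgroup M) where
  res : ∀ k, ProjectiveResolution (ModuleCat.of R (M ⧸ powSMul 𝔞 M k))
  pieces : ∀ k j : ℕ, ℤ → AddSubgroup ((res k).complex.X j)
  isGraded : ∀ k, IsGradedResolution 𝒜 (quotientGrading ℳ (powSMul 𝔞 M k)) (res k) (pieces k)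
  finite : ∀ k j, Module.Finite R ((res k).complex.X j)
  pieces_eq_bot : ∀ c, (∀ m < c, ℳ m = ⊥) → ∀ k j, ∀ m < c, pieces k j m = ⊥
  trans : ∀ {k l} (h : k ≤ l), (res l).Hom (res k) (quotientProj 𝔞 M k l h)
  trans_homogeneous : ∀ {k l} (h : k ≤ l) (j : ℕ),
    IsHomogeneousOfDegree (pieces l j) (pieces k j) 0 ((trans h).hom.f j).hom.toAddMonoidHom

lemma exists_resolutionSystem {𝒜 : ℕ → AddSubgroup R} [GradedRing 𝒜] [IsNoetherianRing R]
    {𝔞 : Ideal R} {ℳ : ℤ → AddSubgroup M} [Module.Finite R M] (hℳ : IsGradedModule 𝒜 ℳ)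
    (h𝔞 : ∀ k, IsHomogeneousSubmodule hℳ (powSMul 𝔞 M k)) :
    Nonempty (ResolutionSystem 𝒜 𝔞 ℳ) := by
  have hgr := fun k => isGradedModule_quotientGrading hℳ (h𝔞 k)
  choose P 𝒬 hP hfin hbot using fun k => exists_graded_resolution (hgr k)
  choose u hu using fun (k l : ℕ) (h : k ≤ l) => exists_homogeneous_lift (hgr k) (hP l) (hP k)
    (h := Submodule.factor (Submodule.smul_mono_left (Ideal.pow_le_pow_right h))) (by
      rintro n _ ⟨x, hx, rfl⟩
      rw [add_zero]
      exact ⟨x, hx, rfl⟩)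
  exact ⟨⟨P, 𝒬, hP, hfin, fun c hc k => hbot k c fun m hm => quotientGrading_eq_bot (hc m hm),
    fun {k l} h => u k l h, fun {k l} h => hu k l h⟩⟩

lemma quotientProj_self (𝔞 : Ideal R) (k : ℕ) : quotientProj 𝔞 M k k le_rfl = 𝟙 _ := by
  rw [quotientProj, ← ModuleCat.ofHom_id]
  congr 1
  exact Submodule.linearMap_qext _ (Submodule.factor_comp_mk _)

lemma quotientProj_comp (𝔞 : Ideal R) {k l m : ℕ} (hkl : k ≤ l) (hlm : l ≤ m) :
    quotientProj 𝔞 M l m hlm ≫ quotientProj 𝔞 M k l hkl =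
      quotientProj 𝔞 M k m (hkl.trans hlm) := by
  rw [quotientProj, quotientProj, quotientProj, ← ModuleCat.ofHom_comp, Submodule.factor_comp]

instance (𝔞 : Ideal R) (N : Type u) [AddCommGroup N] [Module R N] (i : ℕ) :
    DirectedSystem (extPow 𝔞 M N i) (fun k l h => extPowMap 𝔞 M N i k l h) where
  map_self k x := by
    change (Abelian.Ext.mk₀ (quotientProj 𝔞 M k k le_rfl)).comp x (zero_add i) = x
    rw [quotientProj_self, Abelian.Ext.mk₀_id_comp]
  map_map m l k hkl hlm x := by
    change (Abelian.Ext.mk₀ (quotientProj 𝔞 M l m hlm)).comp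
      ((Abelian.Ext.mk₀ (quotientProj 𝔞 M k l hkl)).comp x (zero_add i)) (zero_add i) =
        (Abelian.Ext.mk₀ (quotientProj 𝔞 M k m (hkl.trans hlm))).comp x (zero_add i)
    rw [Abelian.Ext.mk₀_comp_mk₀_assoc, quotientProj_comp]

namespace ResolutionSystem

variable {𝒜 : ℕ → AddSubgroup R} {𝔞 : Ideal R} {ℳ : ℤ → AddSubgroup M}
  (S : ResolutionSystem 𝒜 𝔞 ℳ) {N N' N'' : Type u} [AddCommGroup N] [Module R N]
  [AddCommGroup N'] [Module R N'] [AddCommGroup N''] [Module R N''] {i k l : ℕ}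

/-- The class in `H^i_𝔞(M, N)` of a cocycle on the resolution of `M ⧸ 𝔞 ^ k M`. -/
def lcClass (f : (S.res k).complex.X i ⟶ ModuleCat.of R N)
    (hf : (S.res k).complex.d (i + 1) i ≫ f = 0) : genLocalCohomology 𝔞 M N i :=
  Module.DirectLimit.of R ℕ (extPow 𝔞 M N i) (extPowMap 𝔞 M N i) k
    ((S.res k).extMk f (i + 1) rfl hf)

lemma d_comp_trans (h : k ≤ l) {Y : ModuleCat.{u} R} {f : (S.res k).complex.X i ⟶ Y}
    (hf : (S.res k).complex.d (i + 1) i ≫ f = 0) :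
    (S.res l).complex.d (i + 1) i ≫ (S.trans h).hom.f i ≫ f = 0 := by
  rw [← (S.trans h).hom.comm_assoc, hf, Limits.comp_zero]

lemma extPowMap_extMk (h : k ≤ l) (f : (S.res k).complex.X i ⟶ ModuleCat.of R N)
    (hf : (S.res k).complex.d (i + 1) i ≫ f = 0) :
    extPowMap 𝔞 M N i k l h ((S.res k).extMk f (i + 1) rfl hf) =
      (S.res l).extMk ((S.trans h).hom.f i ≫ f) (i + 1) rfl (S.d_comp_trans h hf) :=
  ProjectiveResolution.mk₀_comp_extMk f (i + 1) rfl hf (S.trans h)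

lemma lcClass_trans (h : k ≤ l) (f : (S.res k).complex.X i ⟶ ModuleCat.of R N)
    (hf : (S.res k).complex.d (i + 1) i ≫ f = 0) :
    S.lcClass ((S.trans h).hom.f i ≫ f) (S.d_comp_trans h hf) = S.lcClass f hf := by
  rw [lcClass, ← S.extPowMap_extMk h f hf]
  exact Module.DirectLimit.of_f

lemma lcClass_eq_zero_iff (f : (S.res k).complex.X i ⟶ ModuleCat.of R N)
    (hf : (S.res k).complex.d (i + 1) i ≫ f = 0) :
    S.lcClass f hf = 0 ↔
      ∃ (l : ℕ) (h : k ≤ l), IsCoboundary (S.res l) ((S.trans h).hom.f i ≫ f) := by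
  constructor
  · intro h0
    obtain ⟨l, h, hl⟩ := Module.DirectLimit.of.zero_exact h0
    refine ⟨l, h, ?_⟩
    rwa [S.extPowMap_extMk h f hf, extMk_eq_zero_iff_isCoboundary] at hl
  · rintro ⟨l, h, hl⟩
    rw [← S.lcClass_trans h f hf, lcClass, (extMk_eq_zero_iff_isCoboundary _ _).2 hl, map_zero]

lemma exists_lcClass_eq (e : genLocalCohomology 𝔞 M N i) :
    ∃ (k : ℕ) (f : (S.res k).complex.X i ⟶ ModuleCat.of R N)
      (hf : (S.res k).complex.d (i + 1) i ≫ f = 0), S.lcClass f hf = e := by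
  obtain ⟨k, x, rfl⟩ := Module.DirectLimit.exists_of e
  obtain ⟨f, hf, rfl⟩ := (S.res k).extMk_surjective x (i + 1) rfl
  exact ⟨k, f, hf, rfl⟩

lemma lcClass_eq_of_isCoboundary_sub {f g : (S.res k).complex.X i ⟶ ModuleCat.of R N}
    (hf : (S.res k).complex.d (i + 1) i ≫ f = 0) (hg : (S.res k).complex.d (i + 1) i ≫ g = 0)
    (h : IsCoboundary (S.res k) (f - g)) : S.lcClass f hf = S.lcClass g hg := by
  rw [← sub_eq_zero, lcClass, lcClass, ← map_sub, ProjectiveResolution.sub_extMk,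
    (extMk_eq_zero_iff_isCoboundary _ _).2 h, map_zero]

lemma smul_lcClass (r : R) (f : (S.res k).complex.X i ⟶ ModuleCat.of R N)
    (hf : (S.res k).complex.d (i + 1) i ≫ f = 0) :
    r • S.lcClass f hf = S.lcClass (r • f) (by rw [Linear.comp_smul, hf, smul_zero]) := by
  rw [lcClass, lcClass, ← map_smul, smul_extMk]

lemma sum_lcClass {α : Type*} (s : Finset α)
    (f : α → ((S.res k).complex.X i ⟶ ModuleCat.of R N))
    (hf : ∀ a, (S.res k).complex.d (i + 1) i ≫ f a = 0) :
    ∑ a ∈ s, S.lcClass (f a) (hf a) =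
      S.lcClass (∑ a ∈ s, f a) (by simp [Preadditive.comp_sum, hf]) := by
  simp_rw [lcClass]
  rw [← map_sum, sum_extMk]

lemma lcClass_comp_eq_zero {f : (S.res k).complex.X i ⟶ ModuleCat.of R N}
    {hf : (S.res k).complex.d (i + 1) i ≫ f = 0} (h : S.lcClass f hf = 0) (g : N →ₗ[R] N') :
    S.lcClass (f ≫ ModuleCat.ofHom g) (by rw [reassoc_of% hf, Limits.zero_comp]) = 0 := by
  rw [lcClass_eq_zero_iff] at h ⊢
  obtain ⟨l, hl, hb⟩ := h
  refine ⟨l, hl, ?_⟩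
  have := hb.comp (ModuleCat.ofHom g)
  rwa [Category.assoc] at this

/-- A class with values in a finite power vanishes if its components do. -/
lemma lcClass_eq_zero_of_pi {α : Type} [Finite α]
    {f : (S.res k).complex.X i ⟶ ModuleCat.of R (α → N)}
    (hf : (S.res k).complex.d (i + 1) i ≫ f = 0)
    (h : ∀ a, S.lcClass (f ≫ ModuleCat.ofHom (LinearMap.proj a : (α → N) →ₗ[R] N))
      (by rw [reassoc_of% hf, Limits.zero_comp]) = 0) : S.lcClass f hf = 0 := by
  classical
  have := Fintype.ofFinite α
  have key : f = ∑ a : α, (f ≫ ModuleCat.ofHom (LinearMap.proj a : (α → N) →ₗ[R] N)) ≫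
      ModuleCat.ofHom (LinearMap.single R (fun _ => N) a) := by
    refine ModuleCat.hom_ext (LinearMap.ext fun x => ?_)
    simp only [ModuleCat.hom_sum, LinearMap.sum_apply]
    exact (Finset.univ_sum_single (f.hom x)).symm
  have h2 := S.sum_lcClass Finset.univ (fun a : α =>
    (f ≫ ModuleCat.ofHom (LinearMap.proj a : (α → N) →ₗ[R] N)) ≫
      ModuleCat.ofHom (LinearMap.single R (fun _ => N) a))
    (fun a => by simp only [← Category.assoc, hf, Limits.zero_comp])
  simp_rw [← key] at h2
  rw [← h2]
  exact Finset.sum_eq_zero fun a _ => S.lcClass_comp_eq_zero (h a) _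

include S in
/-- Exactness of `H^i_𝔞(M, N) → H^i_𝔞(M, N'') → H^{i+1}_𝔞(M, N')` bounds the annihilator of the
middle term. -/
lemma annihilator_mul_le {ι : N' →ₗ[R] N} {q : N →ₗ[R] N''} (hι : Function.Injective ι)
    (hex : Function.Exact ι q) (hq : Function.Surjective q) (i : ℕ) {I J : Ideal R}
    (hI : I ≤ Module.annihilator R (genLocalCohomology 𝔞 M N i))
    (hJ : J ≤ Module.annihilator R (genLocalCohomology 𝔞 M N' (i + 1))) :
    I * J ≤ Module.annihilator R (genLocalCohomology 𝔞 M N'' i) := by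
  refine Ideal.mul_le.2 fun a ha b hb => Module.mem_annihilator.2 fun e => ?_
  obtain ⟨k, f, hf, rfl⟩ := S.exists_lcClass_eq e
  obtain ⟨g, rfl⟩ := exists_lift_of_projective hq f
  obtain ⟨p, hp⟩ := exists_factor_of_comp_eq_zero hι hex ((S.res k).complex.d (i + 1) i ≫ g)
    (by rw [Category.assoc, hf])
  have hpd : (S.res k).complex.d (i + 1 + 1) (i + 1) ≫ p = 0 :=
    eq_of_comp_injective hι (by rw [Category.assoc, hp]; simp)
  have hb0 := Module.mem_annihilator.1 (hJ hb) (S.lcClass p hpd)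
  rw [smul_lcClass, lcClass_eq_zero_iff] at hb0
  obtain ⟨l, hl, s, hs⟩ := hb0
  -- subtracting `s` corrects `b • g` to a cocycle that lifts `b • f`
  set F := b • (S.trans hl).hom.f i ≫ g - s ≫ ModuleCat.ofHom ι with hF
  have hFd : (S.res l).complex.d (i + 1) i ≫ F = 0 := by
    rw [hF, Preadditive.comp_sub, Linear.comp_smul, ← (S.trans hl).hom.comm_assoc, ← hp,
      ← Category.assoc _ s, hs, sub_eq_zero]
    simp only [Linear.comp_smul, Linear.smul_comp, Category.assoc]
  have ha0 := Module.mem_annihilator.1 (hI ha) (S.lcClass F hFd)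
  rw [smul_lcClass] at ha0
  have h1 := S.lcClass_comp_eq_zero ha0 q
  rw [smul_lcClass, ← S.lcClass_trans hl, ← h1]
  have hιq : ModuleCat.ofHom ι ≫ ModuleCat.ofHom q = 0 := by
    ext x
    exact hex.apply_apply_eq_zero x
  congr 1
  simp only [hF, Linear.smul_comp, Linear.comp_smul, Preadditive.sub_comp, Category.assoc, hιq,
    Limits.comp_zero, sub_zero, smul_smul]

end ResolutionSystem

end System

/-! ### Degrees and exactness -/

section HomogeneousParts

variable {𝒜 : ℕ → AddSubgroup R} [GradedRing 𝒜] {X N N' : Type u} [AddCommGroup X] [Module R X]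
  [AddCommGroup N] [Module R N] [AddCommGroup N'] [Module R N'] {𝒳 : ℤ → AddSubgroup X}
  {P : ProjectiveResolution (ModuleCat.of R X)} {𝒬 : ∀ j : ℕ, ℤ → AddSubgroup (P.complex.X j)}
  {𝒩 : ℤ → AddSubgroup N} {𝒩' : ℤ → AddSubgroup N'}

/-- The homogeneous part of a cochain on a graded resolution. -/
def cochainPart (hP : IsGradedResolution 𝒜 𝒳 P 𝒬) (h𝒩 : IsGradedModule 𝒜 𝒩) (n : ℤ) {i : ℕ}
    (f : P.complex.X i ⟶ ModuleCat.of R N) : P.complex.X i ⟶ ModuleCat.of R N :=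
  ModuleCat.ofHom (degPart (hP.graded i) h𝒩 n f.hom)

lemma IsHomogeneousOfDegree.comp_ofHom {Y : ModuleCat.{u} R} {𝒴 : ℤ → AddSubgroup Y} {n : ℤ}
    {f : Y ⟶ ModuleCat.of R N} (hf : IsHomogeneousOfDegree 𝒴 𝒩 n f.hom.toAddMonoidHom)
    {g : N →ₗ[R] N'} (hg : IsHomogeneousOfDegree 𝒩 𝒩' 0 g.toAddMonoidHom) :
    IsHomogeneousOfDegree 𝒴 𝒩' n (f ≫ ModuleCat.ofHom g).hom.toAddMonoidHom := fun m x hx => by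
  have := hg _ _ (hf m x hx)
  rwa [add_zero] at this

variable (hP : IsGradedResolution 𝒜 𝒳 P 𝒬) (h𝒩 : IsGradedModule 𝒜 𝒩) (n : ℤ) {i : ℕ}

lemma isHomogeneousOfDegree_cochainPart (f : P.complex.X i ⟶ ModuleCat.of R N) :
    IsHomogeneousOfDegree (𝒬 i) 𝒩 n (cochainPart hP h𝒩 n f).hom.toAddMonoidHom :=
  isHomogeneousOfDegree_degPart (hP.graded i) h𝒩 n f.hom

lemma cochainPart_eq_self {f : P.complex.X i ⟶ ModuleCat.of R N}
    (hf : IsHomogeneousOfDegree (𝒬 i) 𝒩 n f.hom.toAddMonoidHom) : cochainPart hP h𝒩 n f = f :=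
  ModuleCat.hom_ext (degPart_eq_self (hP.graded i) h𝒩 hf)

lemma cochainPart_zero : cochainPart hP h𝒩 n (0 : P.complex.X i ⟶ ModuleCat.of R N) = 0 :=
  ModuleCat.hom_ext (degPart_zero (hP.graded i) h𝒩 n)

lemma cochainPart_sub (f g : P.complex.X i ⟶ ModuleCat.of R N) :
    cochainPart hP h𝒩 n (f - g) = cochainPart hP h𝒩 n f - cochainPart hP h𝒩 n g :=
  ModuleCat.hom_ext (degPart_sub (hP.graded i) h𝒩 n f.hom g.hom)

lemma cochainPart_d_comp (g : P.complex.X i ⟶ ModuleCat.of R N) :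
    cochainPart hP h𝒩 n (P.complex.d (i + 1) i ≫ g) =
      P.complex.d (i + 1) i ≫ cochainPart hP h𝒩 n g :=
  ModuleCat.hom_ext (degPart_comp_right (hP.graded (i + 1)) (hP.graded i) h𝒩 g.hom
    (hP.differential (i + 1) i))

lemma cochainPart_comp {h𝒩 : IsGradedModule 𝒜 𝒩} (h𝒩' : IsGradedModule 𝒜 𝒩')
    (f : P.complex.X i ⟶ ModuleCat.of R N) {g : N →ₗ[R] N'}
    (hg : IsHomogeneousOfDegree 𝒩 𝒩' 0 g.toAddMonoidHom) :
    cochainPart hP h𝒩' n (f ≫ ModuleCat.ofHom g) =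
      cochainPart hP h𝒩 n f ≫ ModuleCat.ofHom g :=
  ModuleCat.hom_ext (degPart_comp_left (hP.graded i) h𝒩 h𝒩' f.hom hg)

lemma IsCoboundary.cochainPart {f : P.complex.X i ⟶ ModuleCat.of R N} (hf : IsCoboundary P f) :
    IsCoboundary P (cochainPart hP h𝒩 n f) := by
  cases i with
  | zero =>
    have hf : f = 0 := hf
    rw [hf, cochainPart_zero]
    rfl
  | succ j =>
    obtain ⟨g, rfl⟩ := hf
    exact ⟨_, (cochainPart_d_comp hP h𝒩 n g).symm⟩

lemma exists_sum_cochainPart [Module.Finite R (P.complex.X i)]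
    (f : P.complex.X i ⟶ ModuleCat.of R N) :
    ∃ s : Finset ℤ, f = ∑ n ∈ s, GradedGLC.cochainPart hP h𝒩 n f := by
  obtain ⟨s, hs⟩ := exists_sum_degPart (hP.graded i) h𝒩 f.hom
  refine ⟨s, ModuleCat.hom_ext ?_⟩
  rw [ModuleCat.hom_sum]
  exact hs

end HomogeneousParts

namespace ResolutionSystem

variable {M : Type u} [AddCommGroup M] [Module R M]
  {𝒜 : ℕ → AddSubgroup R} [GradedRing 𝒜] {𝔞 : Ideal R} {ℳ : ℤ → AddSubgroup M}
  (S : ResolutionSystem 𝒜 𝔞 ℳ) {N N' N'' : Type u} [AddCommGroup N] [Module R N]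
  [AddCommGroup N'] [Module R N'] [AddCommGroup N''] [Module R N'']
  {𝒩 : ℤ → AddSubgroup N} {𝒩' : ℤ → AddSubgroup N'} {𝒩'' : ℤ → AddSubgroup N''}

/-- The classes of the homogeneous cocycles of degree `n` vanish in `H^i_𝔞(M, N)`. -/
def VanishesInDegree (𝒩 : ℤ → AddSubgroup N) (i : ℕ) (n : ℤ) : Prop :=
  ∀ (k : ℕ) (f : (S.res k).complex.X i ⟶ ModuleCat.of R N)
    (hf : (S.res k).complex.d (i + 1) i ≫ f = 0),
    IsHomogeneousOfDegree (S.pieces k i) 𝒩 n f.hom.toAddMonoidHom → S.lcClass f hf = 0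

variable {i k : ℕ} {n : ℤ}

section Degree

variable {hℳ : IsGradedModule 𝒜 ℳ} (h𝔞 : ∀ k, IsHomogeneousSubmodule hℳ (powSMul 𝔞 M k))

include S h𝔞

lemma mem_genLocalCohomologyDegree (f : (S.res k).complex.X i ⟶ ModuleCat.of R N)
    (hf : (S.res k).complex.d (i + 1) i ≫ f = 0)
    (hfn : IsHomogeneousOfDegree (S.pieces k i) 𝒩 n f.hom.toAddMonoidHom) :
    S.lcClass f hf ∈ genLocalCohomologyDegree 𝔞 𝒜 ℳ 𝒩 i n := by
  refine AddSubgroup.mem_iSup_of_mem k ⟨_, ?_, rfl⟩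
  rw [extDegree_eq_extDegreeOf (isGradedModule_quotientGrading hℳ (h𝔞 k)) (S.isGraded k)]
  exact ⟨f, hf, hfn, rfl⟩

/-- A property of classes that is additive holds on a piece of `H^i_𝔞(M, N)` once it holds for the
classes of homogeneous cocycles. -/
lemma genLocalCohomologyDegree_le {p : AddSubgroup (genLocalCohomology 𝔞 M N i)}
    (hp : ∀ (k : ℕ) (f : (S.res k).complex.X i ⟶ ModuleCat.of R N)
      (hf : (S.res k).complex.d (i + 1) i ≫ f = 0),
      IsHomogeneousOfDegree (S.pieces k i) 𝒩 n f.hom.toAddMonoidHom → S.lcClass f hf ∈ p) :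
    genLocalCohomologyDegree 𝔞 𝒜 ℳ 𝒩 i n ≤ p := by
  refine iSup_le fun k => ?_
  rw [extDegree_eq_extDegreeOf (isGradedModule_quotientGrading hℳ (h𝔞 k)) (S.isGraded k)]
  rintro _ ⟨_, ⟨f, hf, hfn, rfl⟩, rfl⟩
  exact hp k f hf hfn

lemma genLocalCohomologyDegree_eq_bot_iff :
    genLocalCohomologyDegree 𝔞 𝒜 ℳ 𝒩 i n = ⊥ ↔ S.VanishesInDegree 𝒩 i n := by
  constructor
  · intro h k f hf hfn
    have := S.mem_genLocalCohomologyDegree h𝔞 f hf hfn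
    rwa [h, AddSubgroup.mem_bot] at this
  · intro h
    rw [eq_bot_iff]
    exact S.genLocalCohomologyDegree_le h𝔞 fun k f hf hfn =>
      AddSubgroup.mem_bot.2 (h k f hf hfn)

/-- The pieces of `H^i_𝔞(M, N)` span, since a cocycle on a finitely generated module is a finite
sum of homogeneous cocycles. -/
lemma iSup_genLocalCohomologyDegree (h𝒩 : IsGradedModule 𝒜 𝒩) (i : ℕ) :
    ⨆ n, genLocalCohomologyDegree 𝔞 𝒜 ℳ 𝒩 i n = ⊤ := by
  rw [← top_le_iff]
  intro e _
  obtain ⟨k, f, hf, rfl⟩ := S.exists_lcClass_eq e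
  have := S.finite k i
  obtain ⟨s, hs⟩ := exists_sum_cochainPart (S.isGraded k) h𝒩 f
  have hd : ∀ n, (S.res k).complex.d (i + 1) i ≫ cochainPart (S.isGraded k) h𝒩 n f = 0 :=
    fun n => by rw [← cochainPart_d_comp, hf, cochainPart_zero]
  have key := S.sum_lcClass s (fun n => cochainPart (S.isGraded k) h𝒩 n f) hd
  simp_rw [← hs] at key
  rw [← key]
  exact sum_mem fun n _ => AddSubgroup.mem_iSup_of_mem n (S.mem_genLocalCohomologyDegree h𝔞 _ _
    (isHomogeneousOfDegree_cochainPart _ _ _ _))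

end Degree

section ExactSequence

variable {ι : N' →ₗ[R] N} {q : N →ₗ[R] N''}

/-- Exactness of `H^i_𝔞(M, N') → H^i_𝔞(M, N) → H^i_𝔞(M, N'')` in degree `n`. -/
lemma exists_lcClass_eq_comp (hι : Function.Injective ι) (hex : Function.Exact ι q)
    (hq : Function.Surjective q) (h𝒩' : IsGradedModule 𝒜 𝒩') (h𝒩 : IsGradedModule 𝒜 𝒩)
    (hιh : IsHomogeneousOfDegree 𝒩' 𝒩 0 ι.toAddMonoidHom)
    (f : (S.res k).complex.X i ⟶ ModuleCat.of R N)
    (hf : (S.res k).complex.d (i + 1) i ≫ f = 0)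
    (hfn : IsHomogeneousOfDegree (S.pieces k i) 𝒩 n f.hom.toAddMonoidHom)
    (h0 : S.lcClass (f ≫ ModuleCat.ofHom q) (by rw [reassoc_of% hf, Limits.zero_comp]) = 0) :
    ∃ (l : ℕ) (f' : (S.res l).complex.X i ⟶ ModuleCat.of R N')
      (hf' : (S.res l).complex.d (i + 1) i ≫ f' = 0),
      IsHomogeneousOfDegree (S.pieces l i) 𝒩' n f'.hom.toAddMonoidHom ∧
      S.lcClass (f' ≫ ModuleCat.ofHom ι) (by rw [reassoc_of% hf', Limits.zero_comp]) =
        S.lcClass f hf := by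
  rw [lcClass_eq_zero_iff] at h0
  obtain ⟨l, hl, hb⟩ := h0
  obtain ⟨f₀, hf₀⟩ := exists_isCoboundary_sub hι hex hq ((S.trans hl).hom.f i ≫ f)
    (by rwa [Category.assoc])
  have h1 := hf₀.cochainPart (S.isGraded l) h𝒩 n
  have hself : cochainPart (S.isGraded l) h𝒩 n ((S.trans hl).hom.f i ≫ f) =
      (S.trans hl).hom.f i ≫ f := by
    refine cochainPart_eq_self _ _ _ ?_
    have := hfn.comp (S.trans_homogeneous hl i)
    rwa [zero_add] at this
  rw [cochainPart_sub, hself, cochainPart_comp (S.isGraded l) n (h𝒩 := h𝒩') h𝒩 f₀ hιh] at h1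
  set f' := cochainPart (S.isGraded l) h𝒩' n f₀
  have hf'ι : (S.res l).complex.d (i + 1) i ≫ f' ≫ ModuleCat.ofHom ι = 0 := by
    have := h1.d_comp
    rw [Preadditive.comp_sub, S.d_comp_trans hl hf, zero_sub, neg_eq_zero] at this
    exact this
  have hf' : (S.res l).complex.d (i + 1) i ≫ f' = 0 :=
    eq_of_comp_injective hι (by rw [Category.assoc, hf'ι, Limits.zero_comp])
  refine ⟨l, f', hf', isHomogeneousOfDegree_cochainPart _ _ _ _, ?_⟩
  rw [← S.lcClass_trans hl f hf]
  exact (S.lcClass_eq_of_isCoboundary_sub _ _ h1).symm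

lemma VanishesInDegree.middle (hι : Function.Injective ι) (hex : Function.Exact ι q)
    (hq : Function.Surjective q) (h𝒩' : IsGradedModule 𝒜 𝒩') (h𝒩 : IsGradedModule 𝒜 𝒩)
    (hιh : IsHomogeneousOfDegree 𝒩' 𝒩 0 ι.toAddMonoidHom)
    (hqh : IsHomogeneousOfDegree 𝒩 𝒩'' 0 q.toAddMonoidHom)
    (h' : S.VanishesInDegree 𝒩' i n) (h'' : S.VanishesInDegree 𝒩'' i n) :
    S.VanishesInDegree 𝒩 i n := by
  intro k f hf hfn
  obtain ⟨l, f', hf', hfn', heq⟩ := S.exists_lcClass_eq_comp hι hex hq h𝒩' h𝒩 hιh f hf hfn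
    (h'' k _ _ (hfn.comp_ofHom hqh))
  rw [← heq]
  exact S.lcClass_comp_eq_zero (h' l f' hf' hfn') ι

lemma lcClass_eq_zero_of_isCoboundary_comp (hι : Function.Injective ι)
    (hex : Function.Exact ι q) (hq : Function.Surjective q) (h𝒩 : IsGradedModule 𝒜 𝒩)
    (hιh : IsHomogeneousOfDegree 𝒩' 𝒩 0 ι.toAddMonoidHom)
    (hqh : IsHomogeneousOfDegree 𝒩 𝒩'' 0 q.toAddMonoidHom)
    (h'' : ∀ j, j + 1 = i → S.VanishesInDegree 𝒩'' j n)
    (f : (S.res k).complex.X i ⟶ ModuleCat.of R N')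
    (hf : (S.res k).complex.d (i + 1) i ≫ f = 0)
    (hfn : IsHomogeneousOfDegree (S.pieces k i) 𝒩' n f.hom.toAddMonoidHom)
    (hb : IsCoboundary (S.res k) (f ≫ ModuleCat.ofHom ι)) :
    S.lcClass f hf = 0 := by
  rw [lcClass_eq_zero_iff]
  cases i with
  | zero =>
    have : f = 0 := eq_of_comp_injective hι (by rw [Limits.zero_comp]; exact hb)
    exact ⟨k, le_rfl, by rw [this, Limits.comp_zero]; rfl⟩
  | succ j =>
    obtain ⟨g₀, hg₀⟩ := hb
    -- replacing `g₀` by its part of degree `n` makes its image in `N''` a cocycle of degree `n`,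
    -- to which the vanishing in degree `n` applies
    set g := cochainPart (S.isGraded k) h𝒩 n g₀
    have hg : (S.res k).complex.d (j + 1) j ≫ g = f ≫ ModuleCat.ofHom ι := by
      rw [← cochainPart_d_comp, hg₀]
      exact cochainPart_eq_self _ _ _ (hfn.comp_ofHom hιh)
    have hgq : (S.res k).complex.d (j + 1) j ≫ g ≫ ModuleCat.ofHom q = 0 := by
      rw [← Category.assoc, hg]
      ext x
      exact hex.apply_apply_eq_zero _
    have h0 := h'' j rfl k (g ≫ ModuleCat.ofHom q) hgq
      ((isHomogeneousOfDegree_cochainPart _ _ _ _).comp_ofHom hqh)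
    rw [lcClass_eq_zero_iff] at h0
    obtain ⟨l, hl, hb⟩ := h0
    obtain ⟨p, hp⟩ := exists_isCoboundary_sub hι hex hq ((S.trans hl).hom.f j ≫ g)
      (by rwa [Category.assoc])
    refine ⟨l, hl, p, eq_of_comp_injective hι ?_⟩
    have := hp.d_comp
    rw [Preadditive.comp_sub, sub_eq_zero, ← (S.trans hl).hom.comm_assoc, hg] at this
    rw [Category.assoc, Category.assoc, this]

/-- Exactness of `H^{i-1}_𝔞(M, N'') → H^i_𝔞(M, N') → H^i_𝔞(M, N)` in degree `n`, when the first
group vanishes in that degree. -/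
lemma lcClass_eq_zero_of_comp (hι : Function.Injective ι) (hex : Function.Exact ι q)
    (hq : Function.Surjective q) (h𝒩 : IsGradedModule 𝒜 𝒩)
    (hιh : IsHomogeneousOfDegree 𝒩' 𝒩 0 ι.toAddMonoidHom)
    (hqh : IsHomogeneousOfDegree 𝒩 𝒩'' 0 q.toAddMonoidHom)
    (h'' : ∀ j, j + 1 = i → S.VanishesInDegree 𝒩'' j n)
    (f : (S.res k).complex.X i ⟶ ModuleCat.of R N')
    (hf : (S.res k).complex.d (i + 1) i ≫ f = 0)
    (hfn : IsHomogeneousOfDegree (S.pieces k i) 𝒩' n f.hom.toAddMonoidHom)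
    (h0 : S.lcClass (f ≫ ModuleCat.ofHom ι) (by rw [reassoc_of% hf, Limits.zero_comp]) = 0) :
    S.lcClass f hf = 0 := by
  rw [lcClass_eq_zero_iff] at h0
  obtain ⟨l, hl, hb⟩ := h0
  rw [← S.lcClass_trans hl f hf]
  refine S.lcClass_eq_zero_of_isCoboundary_comp hι hex hq h𝒩 hιh hqh h'' _ _ ?_
    (by rwa [Category.assoc])
  have := hfn.comp (S.trans_homogeneous hl i)
  rwa [zero_add] at this

lemma VanishesInDegree.left (hι : Function.Injective ι) (hex : Function.Exact ι q)
    (hq : Function.Surjective q) (h𝒩 : IsGradedModule 𝒜 𝒩)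
    (hιh : IsHomogeneousOfDegree 𝒩' 𝒩 0 ι.toAddMonoidHom)
    (hqh : IsHomogeneousOfDegree 𝒩 𝒩'' 0 q.toAddMonoidHom)
    (h : S.VanishesInDegree 𝒩 (i + 1) n) (h'' : S.VanishesInDegree 𝒩'' i n) :
    S.VanishesInDegree 𝒩' (i + 1) n := by
  intro k f hf hfn
  refine S.lcClass_eq_zero_of_comp hι hex hq h𝒩 hιh hqh ?_ f hf hfn
    (h k _ _ (hfn.comp_ofHom hιh))
  rintro j hj
  obtain rfl : j = i := by omega
  exact h''

end ExactSequence

end ResolutionSystem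

/-! ### Powers of character modules as coefficients -/

section Character

/-- A character that vanishes on the kernel of a linear map factors through it. -/
lemma exists_character_comp_eq {A B : Type u} [AddCommGroup A] [Module R A] [AddCommGroup B]
    [Module R B] (f : A →ₗ[R] B) (χ : CharacterModule A) (hχ : ∀ x, f x = 0 → χ x = 0) :
    ∃ ψ : CharacterModule B, ∀ x, ψ (f x) = χ x := by
  let χ' : CharacterModule (A ⧸ LinearMap.ker f) :=
    QuotientAddGroup.lift (LinearMap.ker f).toAddSubgroup χ fun x hx => hχ x hx
  obtain ⟨ψ, hψ⟩ := CharacterModule.dual_surjective_of_injective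
    ((LinearMap.ker f).liftQ f le_rfl)
    (LinearMap.ker_eq_bot.1 (Submodule.ker_liftQ_eq_bot _ _ _ le_rfl)) χ'
  exact ⟨ψ, fun x => DFunLike.congr_fun hψ (Submodule.Quotient.mk x)⟩

variable {A B C : Type u} [AddCommGroup A] [Module R A] [AddCommGroup B] [Module R B]
  [AddCommGroup C] [Module R C] (α : Type u)

/-- The map induced by `f : A → B` on powers of character modules. -/
def dualPow (f : A →ₗ[R] B) : (α → CharacterModule B) →ₗ[R] (α → CharacterModule A) :=
  LinearMap.pi fun s => CharacterModule.dual f ∘ₗ LinearMap.proj s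

lemma dualPow_injective {f : A →ₗ[R] B} (hf : Function.Surjective f) :
    Function.Injective (dualPow α f) := fun _ _ h =>
  funext fun s => CharacterModule.dual_injective_of_surjective f hf (congrFun h s)

lemma dualPow_surjective {f : A →ₗ[R] B} (hf : Function.Injective f) :
    Function.Surjective (dualPow α f) := fun χ => by
  choose ψ hψ using fun s => CharacterModule.dual_surjective_of_injective f hf (χ s)
  exact ⟨ψ, funext hψ⟩

lemma dualPow_exact {f : A →ₗ[R] B} {g : B →ₗ[R] C} (hfg : Function.Exact f g) :
    Function.Exact (dualPow α g) (dualPow α f) := by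
  refine LinearMap.exact_of_comp_of_mem_range ?_ fun χ hχ => ?_
  · refine LinearMap.ext fun χ => funext fun s => CharacterModule.ext _ fun x => ?_
    change χ s (g (f x)) = 0
    rw [hfg.apply_apply_eq_zero, map_zero]
  · choose ψ hψ using fun s => exists_character_comp_eq g (χ s) fun x hx => by
      obtain ⟨y, rfl⟩ := (hfg x).1 hx
      exact DFunLike.congr_fun (congrFun hχ s) y
    exact ⟨ψ, funext fun s => CharacterModule.ext _ (hψ s)⟩

/-- The case of `Hom` in the comparison below: if the restriction to `M` of a map
`M ⧸ 𝔞 ^ k M → (Ω^*)^α` lifts to `(G^*)^α`, then already its restriction to some `M ⧸ 𝔞 ^ l M`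
lifts. The Artin–Rees lemma, applied to the image of `M ⊗ Ω` in `M ⊗ G`, provides `l`, uniformly
for the factors of the power. -/
lemma exists_lift_of_lift_restrict [IsNoetherianRing R] (𝔞 : Ideal R) {M Ω G : Type u}
    [AddCommGroup M] [Module R M] [Module.Finite R M] [AddCommGroup Ω] [Module R Ω]
    [AddCommGroup G] [Module R G] [Module.Finite R G] (ι : Ω →ₗ[R] G) {k : ℕ}
    (h : (M ⧸ powSMul 𝔞 M k) →ₗ[R] (α → CharacterModule Ω))
    (g : M →ₗ[R] (α → CharacterModule G))
    (hg : dualPow α ι ∘ₗ g = h ∘ₗ (powSMul 𝔞 M k).mkQ) :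
    ∃ (l : ℕ) (hl : k ≤ l) (g' : (M ⧸ powSMul 𝔞 M l) →ₗ[R] (α → CharacterModule G)),
      dualPow α ι ∘ₗ g' =
        h ∘ₗ Submodule.factor (Submodule.smul_mono_left (Ideal.pow_le_pow_right hl)) := by
  let T := TensorProduct R M G
  let V : Submodule R T := LinearMap.range (ι.lTensor M)
  obtain ⟨c, hc⟩ := 𝔞.exists_pow_inf_eq_pow_smul V
  let γ : α → CharacterModule T := fun s => CharacterModule.uncurry (LinearMap.proj s ∘ₗ g)
  have hγ : ∀ s m x, γ s (m ⊗ₜ x) = g m s x := fun s m x => rfl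
  have hgι : ∀ s m ω, g m s (ι ω) = h ((powSMul 𝔞 M k).mkQ m) s ω := fun s m ω =>
    DFunLike.congr_fun (congrFun (LinearMap.congr_fun hg m) s) ω
  have hvan : ∀ s, ∀ x ∈ 𝔞 ^ k • V, γ s x = 0 := by
    intro s x hx
    refine Submodule.smul_induction_on hx ?_ fun x y hx hy => by rw [map_add, hx, hy, add_zero]
    rintro a ha _ ⟨y, rfl⟩
    induction y using TensorProduct.induction_on with
    | zero => simp
    | add y z hy hz => rw [map_add, smul_add, map_add, hy, hz, add_zero]
    | tmul m ω =>
      have h0 : (powSMul 𝔞 M k).mkQ (a • m) = 0 :=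
        (Submodule.Quotient.mk_eq_zero _).2 (Submodule.smul_mem_smul ha Submodule.mem_top)
      change γ s ((a • m) ⊗ₜ ι ω) = 0
      rw [hγ, hgι, h0, map_zero]
      rfl
  -- By Artin–Rees, the functional `γ s` restricted to `V` factors through the image of `V` in
  -- `T ⧸ 𝔞 ^ (k + c) T`, from where it extends; the extension is the required lift.
  have hAR : 𝔞 ^ (k + c) • (⊤ : Submodule R T) ⊓ V ≤ 𝔞 ^ k • V := by
    rw [hc (k + c) (Nat.le_add_left c k), Nat.add_sub_cancel]
    exact Submodule.smul_mono le_rfl inf_le_right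
  choose ψ hψ using fun s => exists_character_comp_eq
    ((𝔞 ^ (k + c) • (⊤ : Submodule R T)).mkQ ∘ₗ V.subtype) (CharacterModule.dual V.subtype (γ s))
    fun x hx => hvan s x (hAR ⟨(Submodule.Quotient.mk_eq_zero _).1 hx, x.2⟩)
  let g₀ : M →ₗ[R] (α → CharacterModule G) := LinearMap.pi fun s => CharacterModule.curry
    (CharacterModule.dual (𝔞 ^ (k + c) • (⊤ : Submodule R T)).mkQ (ψ s))
  have hg₀ : ∀ m s x, g₀ m s x =
      ψ s ((𝔞 ^ (k + c) • (⊤ : Submodule R T)).mkQ (m ⊗ₜ x)) := fun m s x => rfl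
  have hker : powSMul 𝔞 M (k + c) ≤ LinearMap.ker g₀ := by
    refine Submodule.smul_le.2 fun a ha m _ => LinearMap.mem_ker.2 <|
      funext fun s => CharacterModule.ext _ fun x => ?_
    have h0 : (𝔞 ^ (k + c) • (⊤ : Submodule R T)).mkQ ((a • m) ⊗ₜ x) = 0 := by
      refine (Submodule.Quotient.mk_eq_zero _).2 ?_
      exact Submodule.smul_mem_smul ha (Submodule.mem_top (x := m ⊗ₜ x))
    rw [hg₀, h0, map_zero]
    rfl
  refine ⟨k + c, Nat.le_add_right k c, (powSMul 𝔞 M (k + c)).liftQ g₀ hker, ?_⟩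
  refine Submodule.linearMap_qext _ (LinearMap.ext fun m => funext fun s =>
    CharacterModule.ext _ fun ω => ?_)
  have := hψ s ⟨m ⊗ₜ ι ω, m ⊗ₜ ω, rfl⟩
  exact this.trans (hgι s m ω)

end Character

section Comparison

open Abelian

variable (𝔞 : Ideal R) (α : Type u)

/-- The projection from `M` to `M ⧸ 𝔞 ^ k M`. -/
def projPow (M : Type u) [AddCommGroup M] [Module R M] (k : ℕ) :
    ModuleCat.of R M ⟶ ModuleCat.of R (M ⧸ powSMul 𝔞 M k) :=
  ModuleCat.ofHom (powSMul 𝔞 M k).mkQ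

instance (M : Type u) [AddCommGroup M] [Module R M] (k : ℕ) : Epi (projPow 𝔞 M k) :=
  (ModuleCat.epi_iff_surjective _).2 (Submodule.mkQ_surjective _)

/-- The short exact sequence of powers of character modules dual to
`0 → ker φ → G → W → 0`. -/
def dualComplex {G W : Type u} [AddCommGroup G] [Module R G] [AddCommGroup W] [Module R W]
    (φ : G →ₗ[R] W) : ShortComplex (ModuleCat.{u} R) :=
  ShortComplex.mk (ModuleCat.ofHom (dualPow α φ))
    (ModuleCat.ofHom (dualPow α (LinearMap.ker φ).subtype))
    (ModuleCat.hom_ext (dualPow_exact α (LinearMap.exact_subtype_ker_map φ)).linearMap_comp_eq_zero)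

lemma dualComplex_shortExact {G W : Type u} [AddCommGroup G] [Module R G] [AddCommGroup W]
    [Module R W] {φ : G →ₗ[R] W} (hφ : Function.Surjective φ) :
    (dualComplex α φ).ShortExact where
  exact := (ShortComplex.moduleCat_exact_iff _).2 fun x hx =>
    (dualPow_exact α (LinearMap.exact_subtype_ker_map φ) x).1 hx
  mono_f := (ModuleCat.mono_iff_injective _).2 (dualPow_injective α hφ)
  epi_g := (ModuleCat.epi_iff_surjective _).2 (dualPow_surjective α Subtype.val_injective)

lemma injective_dualPow (G : Type u) [AddCommGroup G] [Module R G] [Module.Flat R G] :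
    Injective (ModuleCat.of R (α → CharacterModule G)) := by
  have := Module.Flat.iff_characterModule_injective.1 (inferInstance : Module.Flat R G)
  exact Module.injective_object_of_injective_module R (α → CharacterModule G)

variable [IsNoetherianRing R] {M : Type u} [AddCommGroup M] [Module R M] [Module.Finite R M]

/-- For coefficients in a power of the character module of a finitely generated module, the kernel
of the restriction from `M ⧸ 𝔞 ^ k M` to `M` dies in the direct limit. The proof shifts dimensions
along `dualComplex`, whose middle term is injective. -/
lemma exists_extPowMap_eq_zero (i : ℕ) : ∀ (W : Type u) [AddCommGroup W] [Module R W]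
    [Module.Finite R W] (k : ℕ) (e : extPow 𝔞 M (α → CharacterModule W) i k),
    (Ext.mk₀ (projPow 𝔞 M k)).comp e (zero_add i) = 0 →
    ∃ (l : ℕ) (h : k ≤ l), extPowMap 𝔞 M (α → CharacterModule W) i k l h e = 0 := by
  induction i with
  | zero =>
    intro W _ _ _ k e he
    have : e = 0 := Ext.precomp_mk₀_injective_of_epi _ (projPow 𝔞 M k) (he.trans (by simp))
    exact ⟨k, le_rfl, by rw [this, map_zero]⟩
  | succ i ih =>
    intro W _ _ _ k e he
    obtain ⟨n, φ, hφ⟩ := Module.Finite.exists_fin' R W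
    have hS := dualComplex_shortExact α hφ
    have hinj : Injective (dualComplex α φ).X₂ := injective_dualPow α (Fin n → R)
    obtain ⟨h, rfl⟩ : ∃ h : Ext (ModuleCat.of R (M ⧸ powSMul 𝔞 M k)) (dualComplex α φ).X₃ i,
        h.comp hS.extClass rfl = e :=
      Ext.covariant_sequence_exact₁ _ hS e (Ext.eq_zero_of_injective _) rfl
    obtain ⟨g, hg⟩ := Ext.covariant_sequence_exact₃ _ hS
      ((Ext.mk₀ (projPow 𝔞 M k)).comp h (zero_add i)) rfl
      ((Ext.comp_assoc _ _ _ _ _ (by omega)).trans he)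
    obtain ⟨l, hl, g', hg'⟩ : ∃ (l : ℕ) (hl : k ≤ l)
        (g' : Ext (ModuleCat.of R (M ⧸ powSMul 𝔞 M l)) (dualComplex α φ).X₂ i),
        g'.comp (Ext.mk₀ (dualComplex α φ).g) (add_zero i) =
          (Ext.mk₀ (quotientProj 𝔞 M k l hl)).comp h (zero_add i) := by
      cases i with
      | zero =>
        obtain ⟨h, rfl⟩ := (Ext.mk₀_bijective _ _).2 h
        obtain ⟨g, rfl⟩ := (Ext.mk₀_bijective _ _).2 g
        rw [Ext.mk₀_comp_mk₀, Ext.mk₀_comp_mk₀] at hg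
        obtain ⟨l, hl, g', hg'⟩ := exists_lift_of_lift_restrict α 𝔞 (LinearMap.ker φ).subtype
          h.hom g.hom (congrArg ModuleCat.Hom.hom ((Ext.mk₀_bijective _ _).1 hg))
        refine ⟨l, hl, Ext.mk₀ (ModuleCat.ofHom g'), ?_⟩
        exact ((Ext.mk₀_comp_mk₀ _ _).trans (congrArg Ext.mk₀ (ModuleCat.hom_ext hg'))).trans
          (Ext.mk₀_comp_mk₀ _ _).symm
      | succ j =>
        obtain ⟨l, hl, h0⟩ := ih (LinearMap.ker φ) k h (by
          rw [Ext.eq_zero_of_injective g, Ext.zero_comp] at hg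
          exact hg.symm)
        exact ⟨l, hl, 0, (Ext.zero_comp _ _ _ _ _).trans h0.symm⟩
    refine ⟨l, hl, ?_⟩
    change (Ext.mk₀ (quotientProj 𝔞 M k l hl)).comp (h.comp hS.extClass rfl) (zero_add _) = 0
    rw [← Ext.comp_assoc _ _ _ (zero_add i) rfl (by omega), ← hg',
      Ext.comp_assoc _ _ _ _ (zero_add 1) (by omega), hS.comp_extClass, Ext.comp_zero]

end Comparison

/-! ### Coefficients in finitely many degrees -/

section Concentrated

variable {𝒜 : ℕ → AddSubgroup R} {M N : Type u} [AddCommGroup M] [AddCommGroup N]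
  [Module R M] [Module R N] {𝒩 : ℤ → AddSubgroup N}

lemma isHomogeneousOfDegree_concentratedGrading (c : ℤ) (f : M →+ N) :
    IsHomogeneousOfDegree (concentratedGrading M c) (concentratedGrading N c) 0 f := by
  intro n x hx
  rw [add_zero]
  by_cases h : n = c
  · simp [concentratedGrading, h]
  · rw [concentratedGrading_of_ne h, AddSubgroup.mem_bot] at hx
    rw [hx, map_zero]
    exact zero_mem _

/-- The maps `[r] ↦ χ (r • t)`, for the characters `χ` of a module `T` killed by `I`. -/
def toCharacterPow (I : Ideal R) {T : Type u} [AddCommGroup T] [Module R T]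
    (hT : ∀ a ∈ I, ∀ x : T, a • x = 0) :
    T →ₗ[R] (CharacterModule T → CharacterModule (R ⧸ I)) where
  toFun t χ := CharacterModule.dual
    (I.liftQ (LinearMap.toSpanSingleton R T t) fun a ha => hT a ha t) χ
  map_add' s t := funext fun χ => CharacterModule.ext _ fun r => by
    obtain ⟨r, rfl⟩ := I.mkQ_surjective r
    exact (congrArg χ (smul_add r s t)).trans (map_add χ _ _)
  map_smul' a t := funext fun χ => CharacterModule.ext _ fun r => by
    obtain ⟨r, rfl⟩ := I.mkQ_surjective r
    exact congrArg χ ((smul_smul r a t).trans (congrArg (· • t) (mul_comm r a)))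

lemma toCharacterPow_injective {I : Ideal R} {T : Type u} [AddCommGroup T] [Module R T]
    (hT : ∀ a ∈ I, ∀ x : T, a • x = 0) : Function.Injective (toCharacterPow I hT) := by
  rw [injective_iff_map_eq_zero]
  intro t ht
  refine CharacterModule.eq_zero_of_character_apply fun χ => ?_
  have : χ ((1 : R) • t) = 0 := DFunLike.congr_fun (congrFun ht χ) (I.mkQ 1)
  rwa [one_smul] at this

variable [GradedRing 𝒜]

/-- The piece of highest degree of a graded module, as a submodule. -/
def topPiece (h𝒩 : IsGradedModule 𝒜 𝒩) (b : ℤ) (hb : ∀ n, b < n → 𝒩 n = ⊥) : Submodule R N where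
  __ := 𝒩 b
  smul_mem' r x hx := by
    refine DirectSum.Decomposition.inductionOn 𝒜 (motive := fun r => r • x ∈ 𝒩 b)
      (by simp) (fun {j} a => ?_) (fun r s hr hs => by rw [add_smul]; exact add_mem hr hs) r
    have := h𝒩.smul_mem j b a x a.2 hx
    rcases Nat.eq_zero_or_pos j with rfl | hj
    · simpa using this
    · rw [hb _ (by omega), AddSubgroup.mem_bot] at this
      rw [this]
      exact zero_mem _

end Concentrated

namespace ResolutionSystem

open Filter

variable {M : Type u} [AddCommGroup M] [Module R M]
  {𝒜 : ℕ → AddSubgroup R} {𝔞 : Ideal R} {ℳ : ℤ → AddSubgroup M}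
  (S : ResolutionSystem 𝒜 𝔞 ℳ) {N : Type u} [AddCommGroup N] [Module R N]
  {𝒩 : ℤ → AddSubgroup N} {i : ℕ} {n : ℤ}

lemma VanishesInDegree.of_forall_eq_zero
    (h : ∀ (k : ℕ) (f : (S.res k).complex.X i ⟶ ModuleCat.of R N),
      IsHomogeneousOfDegree (S.pieces k i) 𝒩 n f.hom.toAddMonoidHom → f = 0) :
    S.VanishesInDegree 𝒩 i n := by
  intro k f hf hfn
  rw [lcClass_eq_zero_iff]
  refine ⟨k, le_rfl, ?_⟩
  rw [h k f hfn, Limits.comp_zero]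
  cases i with
  | zero => rfl
  | succ j => exact ⟨0, Limits.comp_zero⟩

/-- In high degrees there are no nonzero homogeneous cochains, since the resolutions are bounded
below uniformly. -/
lemma eventually_atTop_vanishesInDegree {c : ℤ} (hc : ∀ m < c, ℳ m = ⊥) {b : ℤ}
    (hb : ∀ m, b < m → 𝒩 m = ⊥) (i : ℕ) : ∀ᶠ n in atTop, S.VanishesInDegree 𝒩 i n := by
  filter_upwards [eventually_gt_atTop (b - c)] with n hn
  refine VanishesInDegree.of_forall_eq_zero S fun k f hf => ModuleCat.hom_ext
    (linearMap_ext_of_homogeneous ((S.isGraded k).graded i) fun m x hx => ?_)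
  by_cases hm : m < c
  · rw [S.pieces_eq_bot c hc k i m hm, AddSubgroup.mem_bot] at hx
    rw [hx, map_zero, map_zero]
  · have := hf m x hx
    rw [hb _ (by omega), AddSubgroup.mem_bot] at this
    exact this

variable [GradedRing 𝒜] [IsNoetherianRing R] [Module.Finite R M]
  {hℳ : IsGradedModule 𝒜 ℳ} (h𝔞 : ∀ k, IsHomogeneousSubmodule hℳ (powSMul 𝔞 M k))

include h𝔞

/-- In low degrees the restriction of a homogeneous cocycle to a resolution of `M` is zero, since
the terms of such a resolution are finitely generated. So the classes vanish in low degrees if the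
kernel of the restriction to `M` dies in the limit. -/
lemma eventually_atBot_vanishesInDegree_of_restrict {c : ℤ} (hc : ∀ m < c, 𝒩 m = ⊥)
    (hE : ∀ (k : ℕ) (e : extPow 𝔞 M N i k),
      (Abelian.Ext.mk₀ (projPow 𝔞 M k)).comp e (zero_add i) = 0 →
        ∃ (l : ℕ) (h : k ≤ l), extPowMap 𝔞 M N i k l h e = 0) :
    ∀ᶠ n in atBot, S.VanishesInDegree 𝒩 i n := by
  obtain ⟨P, 𝒬, hP, hfin, -⟩ := exists_graded_resolution hℳ
  have := hfin i
  obtain ⟨t, e, g, hg, -, hspan⟩ := exists_homogeneous_generators (hP.graded i)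
  have hev : ∀ s, ∀ᶠ n in atBot, n < c - e s := fun s => eventually_lt_atBot _
  filter_upwards [eventually_all.2 hev] with n hn k f hf hfn
  obtain ⟨w, hw⟩ := exists_homogeneous_lift (isGradedModule_quotientGrading hℳ (h𝔞 k)) hP
    (S.isGraded k) (isHomogeneousOfDegree_mkQ (powSMul 𝔞 M k))
  have hwf : w.hom.f i ≫ f = 0 := ModuleCat.hom_ext <| LinearMap.ext_on_range hspan fun s => by
    have h1 := hfn _ _ (hw i _ _ (hg s))
    rw [hc _ (by linarith [hn s]), AddSubgroup.mem_bot] at h1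
    exact h1
  have hres := ProjectiveResolution.mk₀_comp_extMk f (i + 1) rfl hf w
  simp_rw [hwf] at hres
  rw [P.extMk_zero] at hres
  obtain ⟨l, hl, h0⟩ := hE k _ hres
  rw [lcClass, ← Module.DirectLimit.of_f (hij := hl), h0, map_zero]

/-- Dimension shifting for coefficients `T` in a single degree: `T` embeds into a power `J` of the
character module of `R ⧸ R_+`, and both `J` and the quotient are again in that degree. -/
lemma eventually_atBot_vanishesInDegree_concentrated (i : ℕ) : ∀ (T : Type u) [AddCommGroup T]
    [Module R T], (∀ a ∈ (HomogeneousIdeal.irrelevant 𝒜).toIdeal, ∀ x : T, a • x = 0) →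
    ∀ c, ∀ᶠ n in atBot, S.VanishesInDegree (concentratedGrading T c) i n := by
  have hgr : ∀ (T : Type u) [AddCommGroup T] [Module R T],
      (∀ a ∈ (HomogeneousIdeal.irrelevant 𝒜).toIdeal, ∀ x : T, a • x = 0) → ∀ c,
      IsGradedModule 𝒜 (concentratedGrading T c) := fun T _ _ hT c =>
    isGradedModule_concentratedGrading c fun j hj a ha => hT a
      (HomogeneousIdeal.mem_irrelevant_of_mem 𝒜 hj ha)
  induction i with
  | zero =>
    intro T _ _ hT c
    refine S.eventually_atBot_vanishesInDegree_of_restrict h𝔞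
      (fun m hm => concentratedGrading_of_ne hm.ne) fun k e he => ⟨k, le_rfl, ?_⟩
    have : e = 0 := Abelian.Ext.precomp_mk₀_injective_of_epi _ (projPow 𝔞 M k)
      (he.trans (by simp))
    rw [this, map_zero]
  | succ i ih =>
    intro T _ _ hT c
    set I := (HomogeneousIdeal.irrelevant 𝒜).toIdeal
    let ι := toCharacterPow I hT
    have hJ : ∀ a ∈ I, ∀ x : CharacterModule T → CharacterModule (R ⧸ I), a • x = 0 := by
      intro a ha x
      refine funext fun χ => CharacterModule.ext _ fun r => ?_
      obtain ⟨r, rfl⟩ := I.mkQ_surjective r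
      have : a • I.mkQ r = 0 := by
        rw [← map_smul]
        exact (Submodule.Quotient.mk_eq_zero _).2 (I.mul_mem_right r ha)
      exact (congrArg (x χ) this).trans (map_zero _)
    have hQ : ∀ a ∈ I, ∀ x : (CharacterModule T → CharacterModule (R ⧸ I)) ⧸ LinearMap.range ι,
        a • x = 0 := by
      intro a ha x
      obtain ⟨x, rfl⟩ := Submodule.mkQ_surjective _ x
      rw [← map_smul, hJ a ha, map_zero]
    filter_upwards [ih _ hQ c, S.eventually_atBot_vanishesInDegree_of_restrict h𝔞 (i := i + 1)
      (fun m hm => concentratedGrading_of_ne hm.ne)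
      (fun k e he => exists_extPowMap_eq_zero 𝔞 (CharacterModule T) (i + 1) (R ⧸ I) k e he)]
      with n hn hn'
    exact VanishesInDegree.left S (toCharacterPow_injective hT) (LinearMap.exact_map_mkQ_range ι)
      (Submodule.mkQ_surjective _) (hgr _ hJ c) (isHomogeneousOfDegree_concentratedGrading c _)
      (isHomogeneousOfDegree_concentratedGrading c _) hn' hn

/-- For coefficients in finitely many degrees, `H^i_𝔞(M, N)` vanishes in low degrees: filter by
degree. -/
lemma eventually_atBot_vanishesInDegree (i : ℕ) (a : ℤ) (t : ℕ) : ∀ (N : Type u) [AddCommGroup N]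
    [Module R N] (𝒩 : ℤ → AddSubgroup N), IsGradedModule 𝒜 𝒩 → (∀ m < a, 𝒩 m = ⊥) →
    (∀ m, a + t ≤ m → 𝒩 m = ⊥) → ∀ᶠ n in atBot, S.VanishesInDegree 𝒩 i n := by
  induction t with
  | zero =>
    intro N _ _ 𝒩 h𝒩 ha hb
    refine Eventually.of_forall fun n => VanishesInDegree.of_forall_eq_zero S fun k f hf =>
      ModuleCat.hom_ext (linearMap_ext_of_homogeneous ((S.isGraded k).graded i) fun m x hx => ?_)
    have := hf m x hx
    rcases lt_or_ge (m + n) a with h | h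
    · rwa [ha _ h] at this
    · rwa [hb _ (by simpa using h)] at this
  | succ t ih =>
    intro N _ _ 𝒩 h𝒩 ha hb
    have hb' : ∀ m, a + t < m → 𝒩 m = ⊥ := fun m hm => hb m (by push_cast; omega)
    let K := topPiece h𝒩 (a + t) hb'
    have hK : IsHomogeneousSubmodule h𝒩 K := fun n x hx => by
      by_cases hn : a + t = n
      · subst hn
        rwa [component_of_mem h𝒩.isInternal hx]
      · rw [component_of_mem_ne h𝒩.isInternal hx hn]
        exact zero_mem _
    have hsub : subGrading 𝒩 K = concentratedGrading K (a + t) := by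
      funext n
      ext x
      by_cases hn : a + t = n
      · subst hn
        have : (x : N) ∈ 𝒩 (a + t) := x.2
        simpa [concentratedGrading, subGrading] using this
      · rw [concentratedGrading_of_ne (Ne.symm hn), AddSubgroup.mem_bot]
        refine ⟨fun hx => Subtype.ext ?_, fun hx => hx ▸ zero_mem _⟩
        exact (component_of_mem h𝒩.isInternal hx).symm.trans
          (component_of_mem_ne h𝒩.isInternal x.2 hn)
    have hKkill : ∀ r ∈ (HomogeneousIdeal.irrelevant 𝒜).toIdeal, ∀ x : K, r • x = 0 := by
      intro r hr x
      classical
      rw [← DirectSum.sum_support_decompose 𝒜 r, Finset.sum_smul]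
      refine Finset.sum_eq_zero fun j hj => Subtype.ext ?_
      rcases Nat.eq_zero_or_pos j with rfl | hj
      · have : (DirectSum.decompose 𝒜 r 0 : R) = 0 := (HomogeneousIdeal.mem_irrelevant_iff 𝒜 r).1 hr
        rw [this, zero_smul]
      · have := h𝒩.smul_mem j (a + t) _ x (DirectSum.decompose 𝒜 r j).2 x.2
        rw [hb' _ (by omega), AddSubgroup.mem_bot] at this
        exact this
    have hsubv := S.eventually_atBot_vanishesInDegree_concentrated h𝔞 i K hKkill (a + t)
    rw [← hsub] at hsubv
    have hquo := ih (N ⧸ K) (quotientGrading 𝒩 K) (isGradedModule_quotientGrading h𝒩 hK)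
      (fun m hm => quotientGrading_eq_bot (ha m hm)) (fun m hm => by
        by_cases h : a + t = m
        · subst h
          rw [eq_bot_iff]
          rintro _ ⟨x, hx, rfl⟩
          exact (Submodule.Quotient.mk_eq_zero _).2 hx
        · exact quotientGrading_eq_bot (hb m (by push_cast; omega)))
    filter_upwards [hsubv, hquo] with n h' h''
    exact VanishesInDegree.middle S Subtype.val_injective (LinearMap.exact_subtype_mkQ K)
      (Submodule.mkQ_surjective _) (isGradedModule_subGrading h𝒩 hK) h𝒩
      (isHomogeneousOfDegree_subtype K) (isHomogeneousOfDegree_mkQ K) h' h''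

/-- For coefficients in finitely many degrees, `H^i_𝔞(M, N)` is finitely graded for all `i`. -/
lemma eventually_cofinite_vanishesInDegree (h𝒩 : IsGradedModule 𝒜 𝒩) {a b c : ℤ}
    (hc : ∀ m < c, ℳ m = ⊥) (ha : ∀ m < a, 𝒩 m = ⊥) (hb : ∀ m, b < m → 𝒩 m = ⊥) (i : ℕ) :
    ∀ᶠ n in cofinite, S.VanishesInDegree 𝒩 i n := by
  rw [Int.cofinite_eq, eventually_sup]
  exact ⟨S.eventually_atBot_vanishesInDegree h𝔞 i a (b + 1 - a).toNat N 𝒩 h𝒩 ha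
    fun m hm => hb m (by omega), S.eventually_atTop_vanishesInDegree hc hb i⟩

end ResolutionSystem

/-! ### Standard graded rings -/

section Standard

variable {𝒜 : ℕ → AddSubgroup R} [GradedRing 𝒜] {M : Type u} [AddCommGroup M] [Module R M]
  {ℳ : ℤ → AddSubgroup M}

lemma isHomogeneousSubmodule_smul_top (hℳ : IsGradedModule 𝒜 ℳ) {I : Ideal R}
    (hI : I.IsHomogeneous 𝒜) : IsHomogeneousSubmodule hℳ (I • ⊤ : Submodule R M) := by
  intro n x hx
  refine Submodule.smul_induction_on hx (fun a ha y _ => ?_)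
    fun x y hx hy => by rw [map_add]; exact add_mem hx hy
  refine homogeneous_induction hℳ.isInternal
    (p := fun y => component hℳ.isInternal n (a • y) ∈ (I • ⊤ : Submodule R M)) (by simp)
    (fun x y hx hy => by rw [smul_add, map_add]; exact add_mem hx hy) (fun m y hy => ?_) y
  classical
  rw [← DirectSum.sum_support_decompose 𝒜 a, Finset.sum_smul, map_sum]
  refine sum_mem fun j _ => ?_
  have hj := hℳ.smul_mem j m _ y (DirectSum.decompose 𝒜 a j).2 hy
  by_cases hn : (j : ℤ) + m = n
  · subst hn
    rw [component_of_mem _ hj]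
    exact Submodule.smul_mem_smul (hI j ha) Submodule.mem_top
  · rw [component_of_mem_ne _ hj hn]
    exact zero_mem _

lemma isHomogeneousSubmodule_powSMul (hℳ : IsGradedModule 𝒜 ℳ) {𝔞 : Ideal R}
    (h𝔞 : 𝔞.IsHomogeneous 𝒜) (k : ℕ) : IsHomogeneousSubmodule hℳ (powSMul 𝔞 M k) := by
  refine isHomogeneousSubmodule_smul_top hℳ ?_
  induction k with
  | zero =>
    rw [pow_zero, Ideal.one_eq_top]
    exact Ideal.IsHomogeneous.top 𝒜
  | succ k ih =>
    rw [pow_succ]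
    exact ih.mul h𝔞

variable (𝒜) in
lemma isHomogeneous_map_sup_irrelevant (𝔞₀ : Ideal (𝒜 0)) :
    (𝔞₀.map (algebraMap (𝒜 0) R) ⊔ (HomogeneousIdeal.irrelevant 𝒜).toIdeal).IsHomogeneous 𝒜 := by
  refine Ideal.IsHomogeneous.sup (Ideal.homogeneous_span 𝒜 _ ?_)
    (HomogeneousIdeal.irrelevant 𝒜).isHomogeneous
  rintro _ ⟨a, -, rfl⟩
  exact ⟨0, a.2⟩

/-- If homogeneous generators of a graded module have no multiples in degree `m`, then the module
vanishes in that degree. -/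
lemma eq_bot_of_generators (hℳ : IsGradedModule 𝒜 ℳ) {t : ℕ} {e : Fin t → ℤ} {g : Fin t → M}
    (hg : ∀ s, g s ∈ ℳ (e s)) (hspan : Submodule.span R (Set.range g) = ⊤) {m : ℤ}
    (hm : ∀ s (j : ℕ), (j : ℤ) + e s = m → ∀ a ∈ 𝒜 j, a • g s = 0) : ℳ m = ⊥ := by
  rw [eq_bot_iff]
  intro x hx
  rw [AddSubgroup.mem_bot, ← component_of_mem hℳ.isInternal hx]
  obtain ⟨r, rfl⟩ := (Submodule.mem_span_range_iff_exists_fun R).1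
    (hspan ▸ Submodule.mem_top (x := x))
  rw [map_sum]
  refine Finset.sum_eq_zero fun s _ => ?_
  classical
  rw [← DirectSum.sum_support_decompose 𝒜 (r s), Finset.sum_smul, map_sum]
  refine Finset.sum_eq_zero fun j _ => ?_
  by_cases hj : (j : ℤ) + e s = m
  · rw [hm s j hj _ (DirectSum.decompose 𝒜 (r s) j).2, map_zero]
  · exact component_of_mem_ne _
      (hℳ.smul_mem j _ _ _ (DirectSum.decompose 𝒜 (r s) j).2 (hg s)) hj

lemma exists_forall_lt_eq_bot (hℳ : IsGradedModule 𝒜 ℳ) [Module.Finite R M] :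
    ∃ c, ∀ m < c, ℳ m = ⊥ := by
  obtain ⟨t, e, g, hg, -, hspan⟩ := exists_homogeneous_generators hℳ
  obtain ⟨c, hc⟩ := (Set.finite_range e).bddBelow
  refine ⟨c, fun m hm => eq_bot_of_generators hℳ hg hspan fun s j hj => ?_⟩
  have : c ≤ e s := hc ⟨s, rfl⟩
  omega

/-- The piece `R_n` of a standard graded ring lies in the `n`-th power of the ideal generated by
`R_1`. -/
lemma le_span_pow_of_adjoin_eq_top (hstd : Algebra.adjoin (𝒜 0) (𝒜 1 : Set R) = ⊤) (n : ℕ)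
    {r : R} (hr : r ∈ 𝒜 n) : r ∈ Ideal.span (𝒜 1 : Set R) ^ n := by
  have key : ∀ r : R, ∀ n, (DirectSum.decompose 𝒜 r n : R) ∈ Ideal.span (𝒜 1 : Set R) ^ n := by
    intro r
    refine Algebra.adjoin_induction (R := 𝒜 0) (s := (𝒜 1 : Set R))
      (p := fun r _ => ∀ n, (DirectSum.decompose 𝒜 r n : R) ∈ Ideal.span (𝒜 1 : Set R) ^ n)
      ?_ ?_ ?_ ?_ (hstd ▸ Algebra.mem_top (x := r))
    · intro x hx n
      by_cases hn : 1 = n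
      · subst hn
        rw [DirectSum.decompose_of_mem_same 𝒜 hx, pow_one]
        exact Ideal.subset_span hx
      · rw [DirectSum.decompose_of_mem_ne 𝒜 hx hn]
        exact zero_mem _
    · intro x n
      by_cases hn : 0 = n
      · subst hn
        simp
      · change (DirectSum.decompose 𝒜 (x : R) n : R) ∈ _
        rw [DirectSum.decompose_of_mem_ne 𝒜 x.2 hn]
        exact zero_mem _
    · intro x y _ _ hx hy n
      rw [DirectSum.decompose_add]
      exact add_mem (hx n) (hy n)
    · intro x y _ _ hx hy n
      rw [DirectSum.decompose_mul, DirectSum.coe_mul_apply_eq_sum_antidiagonal]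
      refine sum_mem fun p hp => ?_
      rw [← Finset.HasAntidiagonal.mem_antidiagonal.1 hp, pow_add]
      exact Ideal.mul_mem_mul (hx _) (hy _)
  rw [← DirectSum.decompose_of_mem_same 𝒜 hr]
  exact key r n

variable (𝒜) in
lemma span_one_le_irrelevant :
    Ideal.span (𝒜 1 : Set R) ≤ (HomogeneousIdeal.irrelevant 𝒜).toIdeal :=
  Ideal.span_le.2 fun _ hx => HomogeneousIdeal.mem_irrelevant_of_mem 𝒜 one_pos hx

lemma mem_irrelevant_pow (hstd : Algebra.adjoin (𝒜 0) (𝒜 1 : Set R) = ⊤) {n t : ℕ} (h : t ≤ n)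
    {r : R} (hr : r ∈ 𝒜 n) : r ∈ (HomogeneousIdeal.irrelevant 𝒜).toIdeal ^ t :=
  Ideal.pow_le_pow_right h
    (Ideal.pow_right_mono (span_one_le_irrelevant 𝒜) n (le_span_pow_of_adjoin_eq_top hstd n hr))

lemma irrelevant_le_span_one (hstd : Algebra.adjoin (𝒜 0) (𝒜 1 : Set R) = ⊤) :
    (HomogeneousIdeal.irrelevant 𝒜).toIdeal ≤ Ideal.span (𝒜 1 : Set R) :=
  (HomogeneousIdeal.toIdeal_irrelevant_le 𝒜).2 fun i hi _ hr =>
    Ideal.pow_le_self (Nat.pos_iff_ne_zero.1 hi) (le_span_pow_of_adjoin_eq_top hstd i hr)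

lemma irrelevant_pow_eq_span (hstd : Algebra.adjoin (𝒜 0) (𝒜 1 : Set R) = ⊤) (t : ℕ) :
    (HomogeneousIdeal.irrelevant 𝒜).toIdeal ^ t = Ideal.span (𝒜 t : Set R) := by
  refine le_antisymm ?_ (Ideal.span_le.2 fun r hr => mem_irrelevant_pow hstd le_rfl hr)
  induction t with
  | zero =>
    rw [pow_zero, Ideal.one_eq_top, top_le_iff]
    exact Ideal.eq_top_of_isUnit_mem _ (Ideal.subset_span (SetLike.GradedOne.one_mem (A := 𝒜)))
      isUnit_one
  | succ t ih =>
    rw [pow_succ]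
    refine (Ideal.mul_mono ih (irrelevant_le_span_one hstd)).trans ?_
    rw [Ideal.span_mul_span']
    refine Ideal.span_mono ?_
    rintro _ ⟨a, ha, b, hb, rfl⟩
    exact SetLike.GradedMul.mul_mem ha hb

lemma exists_generators_irrelevant_pow [IsNoetherianRing R]
    (hstd : Algebra.adjoin (𝒜 0) (𝒜 1 : Set R) = ⊤) (t : ℕ) :
    ∃ (r : ℕ) (g : Fin r → R), (∀ s, g s ∈ 𝒜 t) ∧
      (HomogeneousIdeal.irrelevant 𝒜).toIdeal ^ t = Ideal.span (Set.range g) := by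
  obtain ⟨F, hF, hspan⟩ := (Submodule.fg_span_iff_fg_span_finset_subset (𝒜 t : Set R)).1
    (IsNoetherian.noetherian (Ideal.span (𝒜 t : Set R)))
  refine ⟨F.card, fun s => F.equivFin.symm s, fun s => hF (F.equivFin.symm s).2, ?_⟩
  rw [irrelevant_pow_eq_span hstd]
  refine hspan.trans (congrArg Ideal.span ?_)
  ext x
  exact ⟨fun hx => ⟨F.equivFin ⟨x, hx⟩, by simp⟩, by rintro ⟨s, rfl⟩; exact (F.equivFin.symm s).2⟩

/-- A finitely generated graded module killed by a power of the irrelevant ideal is bounded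
above. -/
lemma exists_forall_gt_eq_bot (hstd : Algebra.adjoin (𝒜 0) (𝒜 1 : Set R) = ⊤)
    (hℳ : IsGradedModule 𝒜 ℳ) [Module.Finite R M] {t : ℕ}
    (hM : (HomogeneousIdeal.irrelevant 𝒜).toIdeal ^ t ≤ Module.annihilator R M) :
    ∃ b, ∀ m, b < m → ℳ m = ⊥ := by
  obtain ⟨r, e, g, hg, -, hspan⟩ := exists_homogeneous_generators hℳ
  obtain ⟨b, hb⟩ := (Set.finite_range e).bddAbove
  refine ⟨b + t, fun m hm => eq_bot_of_generators hℳ hg hspan fun s j hj a ha => ?_⟩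
  have : e s ≤ b := hb ⟨s, rfl⟩
  exact Module.mem_annihilator.1 (hM (mem_irrelevant_pow hstd (by omega) ha)) _

end Standard

/-! ### Finite grading and annihilation by powers of the irrelevant ideal -/

namespace ResolutionSystem

open Filter

variable {M : Type u} [AddCommGroup M] [Module R M]
  {𝒜 : ℕ → AddSubgroup R} {𝔞 : Ideal R} {ℳ : ℤ → AddSubgroup M}
  (S : ResolutionSystem 𝒜 𝔞 ℳ) {N : Type u} [AddCommGroup N] [Module R N]
  {𝒩 : ℤ → AddSubgroup N} {i k : ℕ}

lemma lcClass_congr {f g : (S.res k).complex.X i ⟶ ModuleCat.of R N} (h : f = g)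
    (hf : (S.res k).complex.d (i + 1) i ≫ f = 0) :
    S.lcClass f hf = S.lcClass g (h ▸ hf) := by
  subst h
  rfl

include S in
lemma annihilator_le_annihilator_pi {α : Type} [Finite α] (i : ℕ) :
    Module.annihilator R (genLocalCohomology 𝔞 M N i) ≤
      Module.annihilator R (genLocalCohomology 𝔞 M (α → N) i) := by
  refine fun a ha => Module.mem_annihilator.2 fun e => ?_
  obtain ⟨k, f, hf, rfl⟩ := S.exists_lcClass_eq e
  rw [smul_lcClass]
  refine S.lcClass_eq_zero_of_pi _ fun s => ?_
  have h0 := Module.mem_annihilator.1 ha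
    (S.lcClass (f ≫ ModuleCat.ofHom (LinearMap.proj s : (α → N) →ₗ[R] N))
      (by rw [reassoc_of% hf, Limits.zero_comp]))
  rw [smul_lcClass] at h0
  exact (S.lcClass_congr (Linear.smul_comp _ _ _ _ _ _) _).trans h0

variable [GradedRing 𝒜]

/-- If `H^i_𝔞(M, N)` is finitely graded then elements of large degree map it to zero. -/
lemma exists_irrelevant_pow_le_annihilator (hstd : Algebra.adjoin (𝒜 0) (𝒜 1 : Set R) = ⊤)
    {hℳ : IsGradedModule 𝒜 ℳ} (h𝔞 : ∀ k, IsHomogeneousSubmodule hℳ (powSMul 𝔞 M k))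
    (h𝒩 : IsGradedModule 𝒜 𝒩) (h : ∀ᶠ n in cofinite, S.VanishesInDegree 𝒩 i n) :
    ∃ t, (HomogeneousIdeal.irrelevant 𝒜).toIdeal ^ t ≤
      Module.annihilator R (genLocalCohomology 𝔞 M N i) := by
  rw [eventually_cofinite] at h
  obtain ⟨a, ha⟩ := h.bddBelow
  obtain ⟨b, hb⟩ := h.bddAbove
  have hlow : ∀ n < a, S.VanishesInDegree 𝒩 i n := fun n hn => by
    by_contra hv
    exact absurd (ha hv) (not_le.2 hn)
  have hhigh : ∀ n, b < n → S.VanishesInDegree 𝒩 i n := fun n hn => by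
    by_contra hv
    exact absurd (hb hv) (not_le.2 hn)
  -- a shift by `b - a + 1` moves every degree in `[a, b]` beyond `b`
  refine ⟨(b - a + 1).toNat, ?_⟩
  rw [irrelevant_pow_eq_span hstd, Ideal.span_le]
  refine fun r hr => Module.mem_annihilator.2 fun e => ?_
  suffices (⊤ : AddSubgroup (genLocalCohomology 𝔞 M N i)) ≤
      (DistribSMul.toAddMonoidHom (genLocalCohomology 𝔞 M N i) r).ker from
    this (AddSubgroup.mem_top e)
  rw [← S.iSup_genLocalCohomologyDegree h𝔞 h𝒩 i]
  refine iSup_le fun n => S.genLocalCohomologyDegree_le h𝔞 fun k f hf hfn => ?_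
  change r • S.lcClass f hf = 0
  rcases lt_or_ge n a with hn | hn
  · rw [hlow n hn k f hf hfn, smul_zero]
  · rw [smul_lcClass]
    refine hhigh (n + (b - a + 1).toNat) (by omega) k _ _ fun m x hx => ?_
    have := h𝒩.smul_mem _ _ r _ hr (hfn m x hx)
    rwa [add_comm, add_assoc] at this

variable [IsNoetherianRing R] [Module.Finite R M]
  {hℳ : IsGradedModule 𝒜 ℳ} (h𝔞 : ∀ k, IsHomogeneousSubmodule hℳ (powSMul 𝔞 M k))

include h𝔞

/-- If powers of `R_+` kill `H^j_𝔞(M, N)` for all `j ≤ i`, then `H^i_𝔞(M, N)` is finitely graded.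
With `R_+ ^ t` killing `H^i_𝔞(M, N)` and generators `g s` of `R_+ ^ t`, consider the map
`x ↦ (g s • x)` from `N` to a power of `N`. It induces zero on `H^i`, its kernel `Γ` lives in
finitely many degrees, and the induction hypothesis applies to its cokernel. -/
lemma eventually_vanishesInDegree_of_le_annihilator
    (hstd : Algebra.adjoin (𝒜 0) (𝒜 1 : Set R) = ⊤) (i : ℕ) :
    ∀ (N : Type u) [AddCommGroup N] [Module R N] [Module.Finite R N] (𝒩 : ℤ → AddSubgroup N),
      IsGradedModule 𝒜 𝒩 →
      (∀ j ≤ i, ∃ t, (HomogeneousIdeal.irrelevant 𝒜).toIdeal ^ t ≤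
        Module.annihilator R (genLocalCohomology 𝔞 M N j)) →
      ∀ᶠ n in cofinite, S.VanishesInDegree 𝒩 i n := by
  induction i using Nat.strong_induction_on with
  | _ i ih =>
    intro N _ _ _ 𝒩 h𝒩 hN
    obtain ⟨t, ht⟩ := hN i le_rfl
    obtain ⟨r, g, hg, hspan⟩ := exists_generators_irrelevant_pow hstd t
    let 𝒱 : ℤ → AddSubgroup (Fin r → N) := piGrading fun _ n => 𝒩 (n + t)
    have h𝒱 : IsGradedModule 𝒜 𝒱 := isGradedModule_piGrading fun _ => isGradedModule_shift h𝒩 t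
    let v : N →ₗ[R] (Fin r → N) := LinearMap.pi fun s => LinearMap.lsmul R N (g s)
    have hv : IsHomogeneousOfDegree 𝒩 𝒱 0 v.toAddMonoidHom := fun n x hx =>
      mem_piGrading.2 fun s => by
        rw [add_zero, add_comm]
        exact h𝒩.smul_mem t n (g s) x (hg s) hx
    let Γ := LinearMap.ker v
    have hΓ : IsHomogeneousSubmodule h𝒩 Γ := isHomogeneousSubmodule_ker h𝒩 h𝒱 hv
    have h𝒢 := isGradedModule_subGrading h𝒩 hΓ
    have h𝒬 := isGradedModule_quotientGrading h𝒩 hΓ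
    let ι : (N ⧸ Γ) →ₗ[R] (Fin r → N) := Γ.liftQ v le_rfl
    have hι : Function.Injective ι :=
      LinearMap.ker_eq_bot.1 (Submodule.ker_liftQ_eq_bot _ _ _ le_rfl)
    have hιh : IsHomogeneousOfDegree (quotientGrading 𝒩 Γ) 𝒱 0 ι.toAddMonoidHom := by
      rintro n _ ⟨x, hx, rfl⟩
      exact hv n x hx
    have h𝒞 := isGradedModule_quotientGrading h𝒱 (isHomogeneousSubmodule_range h𝒬 h𝒱 hιh)
    have hΓv : ∀ j, ∀ᶠ n in cofinite, S.VanishesInDegree (subGrading 𝒩 Γ) j n := by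
      obtain ⟨c, hc⟩ := exists_forall_lt_eq_bot hℳ
      obtain ⟨a, ha⟩ := exists_forall_lt_eq_bot h𝒢
      obtain ⟨b, hb⟩ := exists_forall_gt_eq_bot hstd h𝒢 (t := t) (by
        rw [hspan, Ideal.span_le]
        rintro _ ⟨s, rfl⟩
        exact Module.mem_annihilator.2 fun x => Subtype.ext (congrFun x.2 s))
      exact S.eventually_cofinite_vanishesInDegree h𝔞 h𝒢 hc ha hb
    have hQ : ∀ j ≤ i, ∃ t, (HomogeneousIdeal.irrelevant 𝒜).toIdeal ^ t ≤
        Module.annihilator R (genLocalCohomology 𝔞 M (N ⧸ Γ) j) := fun j hj => by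
      obtain ⟨p, hp⟩ := hN j hj
      obtain ⟨q, hq⟩ := S.exists_irrelevant_pow_le_annihilator hstd h𝔞 h𝒢 (hΓv (j + 1))
      refine ⟨p + q, ?_⟩
      rw [pow_add]
      exact S.annihilator_mul_le Subtype.val_injective (LinearMap.exact_subtype_mkQ Γ)
        (Submodule.mkQ_surjective _) j hp hq
    have hC : ∀ j < i, ∃ t, (HomogeneousIdeal.irrelevant 𝒜).toIdeal ^ t ≤
        Module.annihilator R
          (genLocalCohomology 𝔞 M ((Fin r → N) ⧸ LinearMap.range ι) j) := fun j hj => by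
      obtain ⟨p, hp⟩ := hN j hj.le
      obtain ⟨q, hq⟩ := hQ (j + 1) hj
      refine ⟨p + q, ?_⟩
      rw [pow_add]
      exact S.annihilator_mul_le hι (LinearMap.exact_map_mkQ_range ι)
        (Submodule.mkQ_surjective _) j (hp.trans (S.annihilator_le_annihilator_pi j)) hq
    have hCv : ∀ᶠ n in cofinite, ∀ j, j + 1 = i →
        S.VanishesInDegree (quotientGrading 𝒱 (LinearMap.range ι)) j n := by
      cases i with
      | zero => exact Eventually.of_forall fun n j hj => by omega
      | succ i =>
        filter_upwards [ih i (Nat.lt_succ_self i) _ _ h𝒞 fun j hj => hC j (by omega)]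
          with n hn j hj
        obtain rfl : j = i := by omega
        exact hn
    filter_upwards [hΓv i, hCv] with n hn hn' k f hf hfn
    -- the components of the image in `H^i` of the power are `g s • f`, and `g s` kills `H^i`
    have hq : S.lcClass (f ≫ ModuleCat.ofHom Γ.mkQ)
        (by rw [reassoc_of% hf, Limits.zero_comp]) = 0 := by
      refine S.lcClass_eq_zero_of_comp hι (LinearMap.exact_map_mkQ_range ι)
        (Submodule.mkQ_surjective _) h𝒱 hιh (isHomogeneousOfDegree_mkQ _) hn' _ _
        (hfn.comp_ofHom (isHomogeneousOfDegree_mkQ Γ)) ?_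
      refine S.lcClass_eq_zero_of_pi _ fun s => ?_
      have h0 := Module.mem_annihilator.1
        (ht (hspan ▸ Ideal.subset_span ⟨s, rfl⟩ : g s ∈ _)) (S.lcClass f hf)
      rw [smul_lcClass] at h0
      exact h0
    obtain ⟨l, f', hf', hfn', heq⟩ := S.exists_lcClass_eq_comp Subtype.val_injective
      (LinearMap.exact_subtype_mkQ Γ) (Submodule.mkQ_surjective _) h𝒢 h𝒩
      (isHomogeneousOfDegree_subtype Γ) f hf hfn hq
    rw [← heq]
    exact S.lcClass_comp_eq_zero (hn l f' hf' hfn') _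

end ResolutionSystem

end

end GradedGLC

theorem mainTheorem5 {R : Type u} [CommRing R] [IsNoetherianRing R]
    (𝒜 : ℕ → AddSubgroup R) [GradedRing 𝒜]
    (hstd : Algebra.adjoin (𝒜 0) (𝒜 1 : Set R) = ⊤)
    (𝔞₀ : Ideal (𝒜 0)) (𝔞 : Ideal R)
    (h𝔞 : 𝔞 = 𝔞₀.map (algebraMap (𝒜 0) R) ⊔ (HomogeneousIdeal.irrelevant 𝒜).toIdeal)
    {M N : Type u} [AddCommGroup M] [Module R M] [Module.Finite R M]
    [AddCommGroup N] [Module R N] [Module.Finite R N]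
    (ℳ : ℤ → AddSubgroup M) (hℳ : GradedGLC.IsGradedModule 𝒜 ℳ)
    (𝒩 : ℤ → AddSubgroup N) (h𝒩 : GradedGLC.IsGradedModule 𝒜 𝒩)
    (hpd : projectiveDimension (ModuleCat.of R M) < ⊤) :
    GradedGLC.upsilon 𝔞 𝒜 ℳ 𝒩 =
      GradedGLC.finitenessDimension 𝔞 M N (HomogeneousIdeal.irrelevant 𝒜).toIdeal := by
  open GradedGLC in
  have hpow := isHomogeneousSubmodule_powSMul hℳ
    (h𝔞 ▸ isHomogeneous_map_sup_irrelevant 𝒜 𝔞₀ : 𝔞.IsHomogeneous 𝒜)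
  obtain ⟨S⟩ := exists_resolutionSystem hℳ hpow
  have hfin : ∀ i, IsFinitelyGraded (genLocalCohomologyDegree 𝔞 𝒜 ℳ 𝒩 i) ↔
      ∀ᶠ n in Filter.cofinite, S.VanishesInDegree 𝒩 i n := fun i => by
    simp_rw [← S.genLocalCohomologyDegree_eq_bot_iff hpow]
    exact Filter.eventually_cofinite.symm
  rw [upsilon, finitenessDimension]
  congr 2
  ext k
  constructor
  · intro h i hi
    obtain ⟨t, ht⟩ := S.exists_irrelevant_pow_le_annihilator hstd hpow h𝒩 ((hfin i).1 (h i hi))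
    exact fun r hr => ⟨t, ht (Ideal.pow_mem_pow hr t)⟩
  · intro h i hi
    exact (hfin i).2 <| S.eventually_vanishesInDegree_of_le_annihilator hpow hstd i N 𝒩 h𝒩
      fun j hj => Ideal.exists_pow_le_of_le_radical_of_fg (h j (hj.trans_lt hi))
        (IsNoetherian.noetherian _)
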